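/- **Setting.** Let $m\le d$, let $\Sigma\in\mathbb R^{d\times d}$ be symmetric positive definite, $T\in\mathbb R^{m\times d}$, and let $q:\mathbb R^m\to[0,\infty)$ be smooth ($C^1$ suffices). Let $\mathbb P$ be a probability distribution on $\mathbb R^d$ with mean $0$ and Lebesgue density $\rho(x)=\phi_{0,\Sigma}(x)\,q(Tx)$, where $\phi_{0,\Sigma}$ is the density of $\mathcal N(0,\Sigma)$. Let $\Pi^*$ be the orthogonal projector of $\mathbb R^d$ onto $\mathcal I=\operatorname{range}(T^\top)$. Let $\mathcal B_d$ be the closed Euclidean unit ball of $\mathbb R^d$ and let $f(x,\omega)$, $x\in\mathbb R^d$, $\omega\in\mathcal B_d$, be a continuously differentiable real function whose partial derivatives $\partial f/\partial x_j$ are continuously differentiable in $\omega$. Let $X\sim\mathbb P$. Suppose that for some constant $f_1^*$ and all $\omega\in\mathcal B_d$, $1\le j\le d$, $$\operatorname{Var}[X_jf(X,\omega)]\le f_1^*,\quad \operatorname{Cov}[X_j\nabla_\omega f(X,\omega)]\le f_1^* I,\quad \operatorname{Var}\Bigl[\tfrac{\partial}{\partial x_j}f(X,\omega)\Bigr]\le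 f_1^*,\quad \operatorname{Cov}\Bigl[\nabla_\omega\tfrac{\partial}{\partial x_j}f(X,\omega)\Bigr]\le f_1^* I$$ (Loewner order for covariance matrices), and that each of these four families $Y(X,\omega)$ has an exponential moment that is finite uniformly in $\omega$: there are $a>0$ and $K<\infty$ with $\mathbb E\,e^{a\|Y(X,\omega)\|_2}\le K$ for all $\omega\in\mathcal B_d$. **Claim.** For every $\mathfrak n_0>1$ there is $\lambda_1^*>0$, which does not depend on $N,L,\omega_1,\dots,\omega_L,\varepsilon$ or the sample, such that the following holds. Let $N\ge1$, let $X_1,\dots,X_N$ be i.i.d. with law $\mathbb P$ on a probability space $\Omega$, let $\omega_1,\dots,\omega_L\in\mathcal B_d$, $h_l(x)=f(x,\omega_l)$, and for $c\in\mathbb R^L$ put $$\hat\gamma(c)=\sum_{l=1}^L c_l\,\frac1N\sum_{i=1}^N X_ih_l(X_i),\qquad \hat\beta(c)=\sum_{l=1}^L c_l\,\frac1N\sum_{i=1}^N\nabla h_l(X_i),$$ and $\mathcal C=\{c\in\mathbb R^L:\|c\|_1\le1,\ \hat\gamma(c)=0\}$ (a random set). Then for every $\varepsilon>0$ there is an event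 $A\subset\Omega$ of probability at least $1-\varepsilon$ such that on $A$, for all $c\in\mathcal C$ simultaneously, $$\|(I-\Pi^*)\hat\beta(c)\|_2\le\sqrt d\,\delta_N\,(1+\|\Sigma^{-1}\|_2),$$ where $\|\Sigma^{-1}\|_2$ is the operator norm and $$\delta_N=N^{-1/2}\inf_{0<\lambda\le\lambda_1^*N^{1/2}}\Bigl\{5\,\mathfrak n_0f_1^*\lambda+2\lambda^{-1}\bigl[4d\log2+\log(2d/\varepsilon)\bigr]\Bigr\}.$$ -/

import Mathlib

open MeasureTheory ProbabilityTheory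

/-- The space `ℝ^d` with its Euclidean norm. -/
abbrev Euc (d : ℕ) : Type := EuclideanSpace ℝ (Fin d)

/-- The closed Euclidean unit ball `B_d` of `ℝ^d`. -/
def unitBall (d : ℕ) : Set (Euc d) := Metric.closedBall 0 1

/-- The density of the centred normal distribution `N(0, S)` on `ℝ^d`. -/
noncomputable def gaussianDensity {d : ℕ} (S : Matrix (Fin d) (Fin d) ℝ) (x : Euc d) : ℝ :=
  (Real.sqrt ((2 * Real.pi) ^ d * S.det))⁻¹ *
    Real.exp (-(1 / 2) * inner ℝ x (Matrix.toEuclideanCLM (𝕜 := ℝ) S⁻¹ x))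

/-- The model: `P` is a probability measure on `ℝ^d` with mean zero and with Lebesgue density
`x ↦ φ_{0,S}(x) q(T x)`, where `S` is positive definite, `T` is an `m × d` matrix with `m ≤ d`,
and `q ≥ 0` is continuously differentiable. -/
structure NGModel {d m : ℕ} (P : Measure (Euc d)) (S : Matrix (Fin d) (Fin d) ℝ)
    (T : Matrix (Fin m) (Fin d) ℝ) (q : Euc m → ℝ) : Prop where
  dim_le : m ≤ d
  isProbabilityMeasure : IsProbabilityMeasure P
  posDef : S.PosDef
  contDiff : ContDiff ℝ 1 q
  nonneg : ∀ z, 0 ≤ q z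
  density : P = (volume : Measure (Euc d)).withDensity
    (fun x => ENNReal.ofReal (gaussianDensity S x * q (Matrix.toEuclideanLin T x)))
  integrable : Integrable (fun x : Euc d => x) P
  mean_zero : ∫ x, x ∂P = 0

/-- The target space: the row space of `T`, that is the range of its transpose, in `ℝ^d`. -/
noncomputable def targetSpace {d m : ℕ} (T : Matrix (Fin m) (Fin d) ℝ) : Submodule ℝ (Euc d) :=
  LinearMap.range (Matrix.toEuclideanLin T.transpose)

/-- The partial derivative of `f (x, w)` with respect to the coordinate `x_j`. -/
noncomputable def partialX {d : ℕ} (f : Euc d → Euc d → ℝ) (j : Fin d) (x w : Euc d) : ℝ :=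
  gradient (fun y => f y w) x j

/-- The gradient in `w` of a function `g (x, w)` whose second argument ranges over the closed
unit ball (at boundary points, the gradient relative to the ball). -/
noncomputable def gradW {d : ℕ} (g : Euc d → Euc d → ℝ) (x w : Euc d) : Euc d :=
  gradientWithin (g x) (unitBall d) w

/-- The covariance matrix of a random vector `Y` of `ℝ^d`. -/
noncomputable def covMat {d : ℕ} (P : Measure (Euc d)) (Y : Euc d → Euc d) :
    Matrix (Fin d) (Fin d) ℝ :=
  Matrix.of fun k l => covariance (fun x => Y x k) (fun x => Y x l) P

/-- Uniform (in `w` in the unit ball) finiteness of an exponential moment of `‖Y(X, w)‖`, where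
`X` has law `P`. In particular all moments of `Y(X, w)` are finite. -/
def UniformExpMoment {d : ℕ} {F : Type} [NormedAddCommGroup F] (P : Measure (Euc d))
    (Y : Euc d → Euc d → F) : Prop :=
  ∃ a : ℝ, 0 < a ∧ ∃ K : NNReal, ∀ w ∈ unitBall d,
    ∫⁻ x, ENNReal.ofReal (Real.exp (a * ‖Y x w‖)) ∂P ≤ (K : ENNReal)

/-- The family `f (x, w)`, `x ∈ ℝ^d`, `w` in the closed unit ball, is continuously
differentiable, and so is each `∂f/∂x_j` as a function of `w`. -/
structure SmoothFamily {d : ℕ} (f : Euc d → Euc d → ℝ) : Prop where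
  contDiffOn : ContDiffOn ℝ 1 (fun p : Euc d × Euc d => f p.1 p.2) (Set.univ ×ˢ unitBall d)
  contDiffOn_partialX : ∀ (j : Fin d) (x : Euc d), ContDiffOn ℝ 1 (partialX f j x) (unitBall d)

/-- The four families `X_j f(X,w)`, `X_j ∇_w f(X,w)`, `∂f/∂x_j (X,w)`, `∇_w ∂f/∂x_j (X,w)` have
uniformly finite exponential moments. -/
structure ExpMoments {d : ℕ} (P : Measure (Euc d)) (f : Euc d → Euc d → ℝ) : Prop where
  val : ∀ j : Fin d, UniformExpMoment P (fun x w => x j * f x w)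
  grad_val : ∀ j : Fin d, UniformExpMoment P (fun x w => x j • gradW f x w)
  deriv : ∀ j : Fin d, UniformExpMoment P (fun x w => partialX f j x w)
  grad_deriv : ∀ j : Fin d, UniformExpMoment P (fun x w => gradW (partialX f j) x w)

/-- The variances and (in the Loewner order) covariance matrices of the four families are bounded
by `f1` and `f1 • I`. -/
structure VarianceBounds {d : ℕ} (P : Measure (Euc d)) (f : Euc d → Euc d → ℝ) (f1 : ℝ) :
    Prop where
  val : ∀ (j : Fin d), ∀ w ∈ unitBall d, variance (fun x => x j * f x w) P ≤ f1
  grad_val : ∀ (j : Fin d), ∀ w ∈ unitBall d,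
    (f1 • (1 : Matrix (Fin d) (Fin d) ℝ) - covMat P (fun x => x j • gradW f x w)).PosSemidef
  deriv : ∀ (j : Fin d), ∀ w ∈ unitBall d, variance (fun x => partialX f j x w) P ≤ f1
  grad_deriv : ∀ (j : Fin d), ∀ w ∈ unitBall d,
    (f1 • (1 : Matrix (Fin d) (Fin d) ℝ) - covMat P (fun x => gradW (partialX f j) x w)).PosSemidef

/-- `γ̂(c) = ∑_l c_l N⁻¹ ∑_i h_l(X_i) X_i` with `h_l = f(·, w_l)`, for the sample `X`. -/
noncomputable def gammaHat {d N L : ℕ} (f : Euc d → Euc d → ℝ) (w : Fin L → Euc d)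
    (X : Fin N → Euc d) (c : Fin L → ℝ) : Euc d :=
  ∑ l, c l • ((N : ℝ)⁻¹ • ∑ i, f (X i) (w l) • X i)

/-- `β̂(c) = ∑_l c_l N⁻¹ ∑_i ∇h_l(X_i)` with `h_l = f(·, w_l)`, for the sample `X`. -/
noncomputable def betaHat {d N L : ℕ} (f : Euc d → Euc d → ℝ) (w : Fin L → Euc d)
    (X : Fin N → Euc d) (c : Fin L → ℝ) : Euc d :=
  ∑ l, c l • ((N : ℝ)⁻¹ • ∑ i, gradient (fun y => f y (w l)) (X i))

/-- The set of all `c ∈ ℝ^L` with `‖c‖₁ ≤ 1` and `γ̂(c) = 0`, for the sample `X`. -/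
def feasibleSet {d N L : ℕ} (f : Euc d → Euc d → ℝ) (w : Fin L → Euc d)
    (X : Fin N → Euc d) : Set (Fin L → ℝ) :=
  {c | ∑ l, |c l| ≤ 1 ∧ gammaHat f w X c = 0}

/-- The rate
`δ_N = N^{-1/2} inf_{0 < t ≤ lam N^{1/2}} {5 n0 f1 t + 2 t⁻¹ [4 d log 2 + log (2 d / ε)]}`. -/
noncomputable def deltaN (d N : ℕ) (n0 f1 lam ε : ℝ) : ℝ :=
  (Real.sqrt N)⁻¹ *
    sInf ((fun t : ℝ => 5 * n0 * f1 * t +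
      2 * t⁻¹ * (4 * d * Real.log 2 + Real.log (2 * d / ε))) '' Set.Ioc 0 (lam * Real.sqrt N))

/-! In a direction `v` with `T v = 0` the factor `q (T x)` is constant, so integrating the
derivative of `h ρ` along `v` gives Stein's identity `⟨E ∇h, v⟩ = ⟨S⁻¹ E[X h], v⟩`. Hence `E ∇h -
S⁻¹ E[X h]` is orthogonal to `ker T`, that is, it lies in the target space
(`sub_toEuclideanCLM_mem_targetSpace`). This relation is linear in `h`, so it passes to `β(c) - S⁻¹
γ(c)`, where `β(c)` and `γ(c)` are the expectations of `betaHat` and `gammaHat` at fixed `c`. When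
`gammaHat` vanishes, `γ(c)` is minus its own sampling error, and the component of `betaHat`
orthogonal to the target space is bounded by the error of `betaHat` plus `‖S⁻¹‖` times that of
`gammaHat` (`norm_sub_starProjection_le`).

What remains is a bound on the sampling errors, uniform in `c`. Since `‖c‖₁ ≤ 1`, each coordinate
error is at most the largest error of a single `w l`, so it suffices to control `2d` scalar
empirical processes over the whole unit ball (`exists_forall_empirical_deviation_le`). The
exponential moments and variance bounds make each centred process sub-Gaussian near the origin with
the variance as parameter (`exists_forall_lintegral_exp_centered_le`). Integrating the gradient
along segments gives the same for increments (`exists_forall_lintegral_exp_increment_le`). Dyadic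
chaining turns this into a uniform tail bound (`exists_measurableSet_forall_abs_le`), valid for
parameters up to a multiple of `√N`. -/

/-! ### Nets of the unit ball by volume comparison. -/

section Nets

variable {E : Type*} [NormedAddCommGroup E] [NormedSpace ℝ E] [FiniteDimensional ℝ E]

/-- Volumetric bound for the size of an `r`-separated subset of the open unit ball. -/
lemma card_le_of_separated_unitBall {r : ℝ} (hr : 0 < r) (s : Finset E)
    (hs : ∀ c ∈ s, ‖c‖ < 1) (h : ∀ c ∈ s, ∀ e ∈ s, c ≠ e → r ≤ ‖c - e‖) :
    (s.card : ℝ) ≤ (1 + 2 / r) ^ Module.finrank ℝ E := by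
  borelize E
  let μ : Measure E := Measure.addHaar
  have hδ : 0 < r / 2 := by positivity
  have hρ : 0 < 1 + r / 2 := by positivity
  have D : Set.Pairwise (s : Set E) (Function.onFun Disjoint fun c => Metric.ball (c : E) (r / 2)) := by
    rintro c hc e he hce
    apply Metric.ball_disjoint_ball
    rw [dist_eq_norm]
    linarith [h c hc e he hce]
  have hsub : (⋃ c ∈ s, Metric.ball (c : E) (r / 2)) ⊆ Metric.ball (0 : E) (1 + r / 2) := by
    refine Set.iUnion₂_subset fun x hx => ?_
    apply Metric.ball_subset_ball'
    rw [dist_zero_right]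
    linarith [hs x hx]
  -- Balls of radius `r / 2` around separated points are disjoint and lie in the ball of radius `1 +
  -- r / 2`; comparing Haar measures gives the ratio `(1 + r / 2) / (r / 2) = 1 + 2 / r`.
  have I : (s.card : ENNReal) * ENNReal.ofReal ((r / 2) ^ Module.finrank ℝ E) * μ (Metric.ball 0 1) ≤
      ENNReal.ofReal ((1 + r / 2) ^ Module.finrank ℝ E) * μ (Metric.ball 0 1) := by
    calc _ = μ (⋃ c ∈ s, Metric.ball (c : E) (r / 2)) := by
          rw [measure_biUnion_finset D fun c _ => measurableSet_ball]
          simp only [μ.addHaar_ball_of_pos _ hδ, Finset.sum_const, nsmul_eq_mul, mul_assoc]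
      _ ≤ _ := measure_mono hsub
      _ = _ := by simp only [μ.addHaar_ball_of_pos _ hρ]
  have J := (ENNReal.mul_le_mul_iff_left (Metric.measure_ball_pos _ _ zero_lt_one).ne'
    measure_ball_lt_top.ne).1 I
  have K := ENNReal.toReal_le_of_le_ofReal (by positivity) J
  rw [ENNReal.toReal_mul, ENNReal.toReal_natCast, ENNReal.toReal_ofReal (by positivity)] at K
  rw [← le_div_iff₀ (by positivity), ← div_pow] at K
  refine K.trans_eq (congrArg (· ^ Module.finrank ℝ E) ?_)
  field_simp
  ring

/-- The open unit ball has an `r`-net with at most `(1 + 2 / r) ^ dim` points. -/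
lemma exists_net_unitBall {r : ℝ} (hr : 0 < r) :
    ∃ s : Finset E, (∀ c ∈ s, ‖c‖ < 1) ∧ (∀ x : E, ‖x‖ < 1 → ∃ c ∈ s, ‖x - c‖ < r) ∧
      (s.card : ℝ) ≤ (1 + 2 / r) ^ Module.finrank ℝ E := by
  classical
  -- A separated set of largest cardinality is a net: a point at distance at least `r` from all its
  -- elements could be added. The volume bound makes the maximum exist.
  let Q : Set ℕ := {n | ∃ s : Finset E, (∀ c ∈ s, ‖c‖ < 1) ∧
    (∀ c ∈ s, ∀ e ∈ s, c ≠ e → r ≤ ‖c - e‖) ∧ s.card = n}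
  have hbdd : BddAbove Q := by
    refine ⟨⌊(1 + 2 / r) ^ Module.finrank ℝ E⌋₊, ?_⟩
    rintro n ⟨s, h1, h2, rfl⟩
    exact Nat.le_floor (card_le_of_separated_unitBall hr s h1 h2)
  have hne : Q.Nonempty := ⟨0, ∅, by simp⟩
  obtain ⟨s, h1, h2, h3⟩ := Nat.sSup_mem hne hbdd
  refine ⟨s, h1, fun x hx => ?_, card_le_of_separated_unitBall hr s h1 h2⟩
  by_contra! hcon
  have hxs : x ∉ s := fun hxs => by
    have := hcon x hxs
    simp at this
    linarith
  have hmem : s.card + 1 ∈ Q := by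
    refine ⟨insert x s, ?_, ?_, Finset.card_insert_of_notMem hxs⟩
    · intro c hc
      rcases Finset.mem_insert.1 hc with rfl | hc
      exacts [hx, h1 c hc]
    · intro c hc e he hce
      rcases Finset.mem_insert.1 hc with rfl | hc' <;>
        rcases Finset.mem_insert.1 he with rfl | he'
      · exact absurd rfl hce
      · exact hcon e he'
      · rw [norm_sub_rev]; exact hcon c hc'
      · exact h2 c hc' e he' hce
  have := le_csSup hbdd hmem
  omega

end Nets

/-! ### Dyadic chaining for sub-Gaussian increments. -/

section Chaining

variable {Ω : Type*} [MeasurableSpace Ω] {μ : Measure Ω}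

lemma sum_half_pow_add (n : ℕ) :
    (1 / 2 : ℝ) ^ (n + 1) + ∑ k ∈ Finset.range (n + 1), (1 / 2 : ℝ) ^ (k + 1) = 1 := by
  induction n with
  | zero => norm_num
  | succ n ih =>
    rw [Finset.sum_range_succ, ← add_assoc, add_right_comm, pow_succ _ (n + 1)]
    linarith

/-- Tail bound for a dyadically weighted sum of logarithms of positive random variables. -/
lemma measure_lt_sum_log_le [IsProbabilityMeasure μ] (Q : ℕ → Ω → ℝ) (B : ℕ → ℝ)
    (hpos : ∀ k o, 0 < Q k o)
    (hmeas : ∀ k, AEMeasurable (Q k) μ)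
    (hint : ∀ k, ∫⁻ o, ENNReal.ofReal (Q k o) ∂μ ≤ ENNReal.ofReal (Real.exp (B k))) (n : ℕ) (y : ℝ) :
    μ {o | y + ∑ k ∈ Finset.range (n + 1), (1 / 2 : ℝ) ^ (k + 1) * B k <
        ∑ k ∈ Finset.range (n + 1), (1 / 2 : ℝ) ^ (k + 1) * Real.log (Q k o)} ≤
      ENNReal.ofReal (Real.exp (-y)) := by
  -- The weights `2^{-(k+1)}`, `k ≤ n`, sum to `1 - 2^{-(n+1)}`. The missing mass is placed on the
  -- constant `1 = exp 0`, so `R` is a true convex combination. Its mean is at most `1`, and by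
  -- Jensen it dominates the exponential of the centred weighted sum of logarithms; Markov's
  -- inequality concludes.
  set R : Ω → ℝ := fun o => (1 / 2 : ℝ) ^ (n + 1) + ∑ k ∈ Finset.range (n + 1),
    (1 / 2 : ℝ) ^ (k + 1) * (Real.exp (-B k) * Q k o) with hR
  have hRmeas : AEMeasurable (fun o => ENNReal.ofReal (R o)) μ := by
    refine AEMeasurable.ennreal_ofReal ?_
    refine AEMeasurable.const_add (Finset.aemeasurable_fun_sum _ fun k _ => ?_) _
    exact ((hmeas k).const_mul _).const_mul _
  have hRint : ∫⁻ o, ENNReal.ofReal (R o) ∂μ ≤ 1 := by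
    have h1 : ∀ o, ENNReal.ofReal (R o) = ENNReal.ofReal ((1 / 2 : ℝ) ^ (n + 1)) +
        ∑ k ∈ Finset.range (n + 1), ENNReal.ofReal ((1 / 2 : ℝ) ^ (k + 1) * Real.exp (-B k)) *
          ENNReal.ofReal (Q k o) := by
      intro o
      have : ∀ k ∈ Finset.range (n + 1), 0 ≤ (1 / 2 : ℝ) ^ (k + 1) * (Real.exp (-B k) * Q k o) :=
        fun k _ => by have := hpos k o; positivity
      rw [hR, ENNReal.ofReal_add (by positivity) (Finset.sum_nonneg this),
        ENNReal.ofReal_sum_of_nonneg this]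
      congr 1
      refine Finset.sum_congr rfl fun k _ => ?_
      rw [← mul_assoc, ENNReal.ofReal_mul (by positivity)]
    simp_rw [h1]
    rw [lintegral_add_left measurable_const, lintegral_finsetSum' _
      fun k _ => ((hmeas k).ennreal_ofReal).const_mul _]
    simp_rw [lintegral_const_mul' _ _ ENNReal.ofReal_ne_top]
    calc _ ≤ ENNReal.ofReal ((1 / 2 : ℝ) ^ (n + 1)) + ∑ k ∈ Finset.range (n + 1),
          ENNReal.ofReal ((1 / 2 : ℝ) ^ (k + 1)) := by
          simp only [lintegral_const, measure_univ, mul_one]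
          gcongr with k _
          refine (mul_le_mul_right (hint k) _).trans ?_
          rw [← ENNReal.ofReal_mul (by positivity), mul_assoc, ← Real.exp_add]
          simp
      _ = 1 := by
          rw [← ENNReal.ofReal_sum_of_nonneg (fun _ _ => by positivity),
            ← ENNReal.ofReal_add (by positivity) (Finset.sum_nonneg fun _ _ => by positivity),
            sum_half_pow_add, ENNReal.ofReal_one]
  have hsub : {o | y + ∑ k ∈ Finset.range (n + 1), (1 / 2 : ℝ) ^ (k + 1) * B k <
        ∑ k ∈ Finset.range (n + 1), (1 / 2 : ℝ) ^ (k + 1) * Real.log (Q k o)} ⊆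
      {o | ENNReal.ofReal (Real.exp y) ≤ ENNReal.ofReal (R o)} := by
    intro o ho
    simp only [Set.mem_ofPred_eq] at ho ⊢
    apply ENNReal.ofReal_le_ofReal
    have hJ := convexOn_exp.map_add_sum_le (t := Finset.range (n + 1)) (v := (1 / 2 : ℝ) ^ (n + 1))
      (q := 0) (w := fun k => (1 / 2 : ℝ) ^ (k + 1)) (p := fun k => Real.log (Q k o) - B k)
      (fun _ _ => by positivity) (sum_half_pow_add n) (fun _ _ => Set.mem_univ _) (by positivity)
      (Set.mem_univ _)
    simp only [smul_eq_mul, mul_zero, zero_add, Real.exp_zero, mul_one] at hJ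
    refine (Real.exp_le_exp.2 ?_).trans (hJ.trans (le_of_eq ?_))
    · simp only [mul_sub, Finset.sum_sub_distrib]
      linarith
    · simp only [hR]
      congr 1
      refine Finset.sum_congr rfl fun k _ => ?_
      rw [sub_eq_neg_add, Real.exp_add, Real.exp_log (hpos k o)]
  refine (measure_mono hsub).trans ((meas_ge_le_lintegral_div hRmeas
    (by simp [Real.exp_pos]) ENNReal.ofReal_ne_top).trans ?_)
  rw [ENNReal.div_le_iff (by simp [Real.exp_pos]) ENNReal.ofReal_ne_top,
    ← ENNReal.ofReal_mul (by positivity), ← Real.exp_add]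
  simpa using hRint

lemma ofReal_exp_le_sum_of_abs {a b : ℝ} (f : Ω → ℝ) (hf : AEMeasurable f μ)
    (h : ∀ t : ℝ, |t| = a →
      ∫⁻ o, ENNReal.ofReal (Real.exp (t * f o)) ∂μ ≤ ENNReal.ofReal (Real.exp b)) (ha : 0 ≤ a) :
    ∫⁻ o, ENNReal.ofReal (Real.exp (a * f o) + Real.exp (-a * f o)) ∂μ ≤
      ENNReal.ofReal (2 * Real.exp b) := by
  have h1 : ∀ o, ENNReal.ofReal (Real.exp (a * f o) + Real.exp (-a * f o)) =
      ENNReal.ofReal (Real.exp (a * f o)) + ENNReal.ofReal (Real.exp (-a * f o)) := fun o =>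
    ENNReal.ofReal_add (by positivity) (by positivity)
  simp_rw [h1]
  rw [lintegral_add_left' (by fun_prop), two_mul, ENNReal.ofReal_add (by positivity) (by positivity)]
  exact add_le_add (h a (abs_of_nonneg ha)) (h (-a) (by rw [abs_neg, abs_of_nonneg ha]))

lemma exp_mul_abs_le (a x : ℝ) :
    Real.exp (a * |x|) ≤ Real.exp (a * x) + Real.exp (-a * x) := by
  rcases abs_cases x with ⟨h, _⟩ | ⟨h, _⟩ <;> rw [h]
  · linarith [Real.exp_pos (-a * x)]
  · rw [mul_neg, neg_mul]; linarith [Real.exp_pos (a * x)]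

/-- The weighted sum of the exponents that occur in dyadic chaining. -/
lemma sum_chaining_exponents_le (d : ℕ) (v : ℝ) (hv : 0 ≤ v) (n : ℕ) :
    ∑ k ∈ Finset.range (n + 1), (1 / 2 : ℝ) ^ (k + 1) *
      (if k = 0 then Real.log 2 + v else Real.log 2 + (k + 2) * d * Real.log 2 + 4 * v) ≤
      Real.log 2 + 2 * d * Real.log 2 + 5 / 2 * v := by
  -- Closed form proved by induction. Its limit explains the constants: `v / 2` from level `0` and
  -- `4 v / 2` from the other levels give `5 / 2`, while `∑_{k ≥ 1} (k + 2) 2^{-(k+1)} = 2`.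
  have h : ∑ k ∈ Finset.range (n + 1), (1 / 2 : ℝ) ^ (k + 1) *
      (if k = 0 then Real.log 2 + v else Real.log 2 + (k + 2) * d * Real.log 2 + 4 * v) =
      1 / 2 * (Real.log 2 + v) + (1 / 2 - (1 / 2) ^ (n + 1)) * (Real.log 2 + 4 * v) +
        (2 - (n + 4) * (1 / 2) ^ (n + 1)) * (d * Real.log 2) := by
    induction n with
    | zero => norm_num
    | succ n ih =>
      rw [Finset.sum_range_succ, ih, if_neg (Nat.succ_ne_zero n), pow_succ _ (n + 1)]
      push_cast
      ring
  rw [h]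
  have h2 : 0 ≤ Real.log 2 := Real.log_nonneg (by norm_num)
  have h3 : 0 ≤ (1 / 2 : ℝ) ^ (n + 1) * (Real.log 2 + 4 * v) := by positivity
  have h4 : 0 ≤ (n + 4) * (1 / 2 : ℝ) ^ (n + 1) * (d * Real.log 2) := by positivity
  nlinarith

/-- Maximal inequality on dyadic nets for a process with sub-Gaussian increments, obtained by
chaining. -/
theorem measure_exists_mem_net_lt_abs_le [IsProbabilityMeasure μ] {E : Type*}
    [NormedAddCommGroup E] {ζ : E → Ω → ℝ} {U : ℕ → Finset E} (d : ℕ) {s lam : ℝ} (hs : 0 ≤ s)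
    (hlam : 0 < lam)
    (hU0 : U 0 = {0}) (hU : ∀ n, ∀ u ∈ U n, ‖u‖ < 1)
    (hcover : ∀ n, ∀ x : E, ‖x‖ < 1 → ∃ c ∈ U n, ‖x - c‖ < (1 / 2) ^ n)
    (hcard : ∀ n, (U n).card ≤ 2 ^ ((n + 2) * d))
    (hmeas : ∀ u, ‖u‖ < 1 → AEMeasurable (ζ u) μ)
    (hzero : ∀ t : ℝ, |t| ≤ lam →
      ∫⁻ o, ENNReal.ofReal (Real.exp (t * ζ 0 o)) ∂μ ≤ ENNReal.ofReal (Real.exp (s * t ^ 2)))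
    (hincr : ∀ u v, ‖u‖ < 1 → ‖v‖ < 1 → ∀ t : ℝ, |t| * ‖u - v‖ ≤ 2 * lam →
      ∫⁻ o, ENNReal.ofReal (Real.exp (t * (ζ u o - ζ v o))) ∂μ ≤
        ENNReal.ofReal (Real.exp (s * (t * ‖u - v‖) ^ 2)))
    (n : ℕ) (y : ℝ) :
    μ {o | ∃ u ∈ U n, y < |ζ u o|} ≤ ENNReal.ofReal (Real.exp
      (-(lam / 2 * y - (Real.log 2 + 2 * d * Real.log 2 + 5 / 2 * (s * lam ^ 2))))) := by
  choose! π hπU hπ using hcover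
  -- The scale balances weight against link length: `2^{-(k+1)} p k = lam / 2` at every level, and a
  -- link from level `k + 1` to level `k` is shorter than `2^{-k}`, so `p (k + 1)` times its length
  -- is at most `2 lam`. This is the range required in `hincr` and the origin of the factor `4` in
  -- `B`.
  set p : ℕ → ℝ := fun k => lam * 2 ^ k with hp
  have hp0 : ∀ k, 0 < p k := fun k => by positivity
  set Δ : ℕ → E → Ω → ℝ := fun k u o => ζ u o - ζ (π k u) o with hΔ
  set Q : ℕ → Ω → ℝ := fun k o => if k = 0 then
      Real.exp (lam * ζ 0 o) + Real.exp (-lam * ζ 0 o) else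
      ∑ u ∈ U k, (Real.exp (p k * Δ (k - 1) u o) + Real.exp (-p k * Δ (k - 1) u o)) with hQ
  set B : ℕ → ℝ := fun k => if k = 0 then Real.log 2 + s * lam ^ 2 else
    Real.log 2 + (k + 2) * d * Real.log 2 + 4 * (s * lam ^ 2) with hB
  have hUne : ∀ k, (U k).Nonempty := fun k => ⟨_, hπU k 0 (by simp)⟩
  have hQpos : ∀ k o, 0 < Q k o := by
    intro k o
    by_cases hk : k = 0
    · simp only [hQ, hk, if_true]; positivity
    · simp only [hQ, if_neg hk]
      exact Finset.sum_pos (fun u _ => by positivity) (hUne k)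
  have hΔmeas : ∀ k, ∀ u ∈ U (k + 1), AEMeasurable (Δ k u) μ := fun k u hu =>
    (hmeas u (hU _ u hu)).sub (hmeas _ (hU _ _ (hπU k u (hU _ u hu))))
  have hQmeas : ∀ k, AEMeasurable (Q k) μ := by
    intro k
    rcases k with _ | k
    · simp only [hQ, if_true]
      have := hmeas 0 (by simp)
      fun_prop
    · simp only [hQ, if_neg (Nat.succ_ne_zero k)]
      refine Finset.aemeasurable_fun_sum _ fun u hu => ?_
      have := hΔmeas k u hu
      simp only [Nat.add_sub_cancel]
      fun_prop
  have hQint : ∀ k, ∫⁻ o, ENNReal.ofReal (Q k o) ∂μ ≤ ENNReal.ofReal (Real.exp (B k)) := by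
    intro k
    rcases k with _ | k
    · simp only [hQ, hB, if_true]
      rw [Real.exp_add, Real.exp_log two_pos]
      refine ofReal_exp_le_sum_of_abs _ (hmeas 0 (by simp)) (fun t ht => ?_) hlam.le
      have := hzero t ht.le
      rwa [← sq_abs, ht] at this
    · simp only [hQ, hB, if_neg (Nat.succ_ne_zero k), Nat.add_sub_cancel]
      have hsum : ∀ o, ENNReal.ofReal (∑ u ∈ U (k + 1),
          (Real.exp (p (k + 1) * Δ k u o) + Real.exp (-p (k + 1) * Δ k u o))) =
          ∑ u ∈ U (k + 1), ENNReal.ofReal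
            (Real.exp (p (k + 1) * Δ k u o) + Real.exp (-p (k + 1) * Δ k u o)) := fun o =>
        ENNReal.ofReal_sum_of_nonneg fun u _ => by positivity
      simp_rw [hsum]
      rw [lintegral_finsetSum']
      swap
      · intro u hu
        have := hΔmeas k u hu
        fun_prop
      calc _ ≤ ∑ u ∈ U (k + 1), ENNReal.ofReal (2 * Real.exp (4 * (s * lam ^ 2))) := by
            refine Finset.sum_le_sum fun u hu => ?_
            refine ofReal_exp_le_sum_of_abs _ (hΔmeas k u hu) (fun t ht => ?_) (hp0 _).le
            have hb : |t| * ‖u - π k u‖ ≤ 2 * lam := by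
              rw [ht]
              calc p (k + 1) * ‖u - π k u‖ ≤ p (k + 1) * (1 / 2) ^ k := by
                    have := hp0 (k + 1)
                    gcongr
                    exact (hπ k u (hU _ u hu)).le
                _ = 2 * lam := by
                    simp only [hp, pow_succ, one_div, inv_pow]
                    field_simp
            refine (hincr u (π k u) (hU _ u hu) (hU _ _ (hπU k u (hU _ u hu))) t hb).trans ?_
            apply ENNReal.ofReal_le_ofReal
            rw [Real.exp_le_exp]
            have h1 : (t * ‖u - π k u‖) ^ 2 ≤ (2 * lam) ^ 2 := by
              rw [← sq_abs (t * _), abs_mul, abs_norm]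
              exact pow_le_pow_left₀ (by positivity) hb 2
            nlinarith [mul_le_mul_of_nonneg_left h1 hs]
        _ = ENNReal.ofReal ((U (k + 1)).card * (2 * Real.exp (4 * (s * lam ^ 2)))) := by
            rw [Finset.sum_const, nsmul_eq_mul,
              ENNReal.ofReal_mul (p := ((U (k + 1)).card : ℝ)) (by positivity),
              ENNReal.ofReal_natCast]
        _ ≤ _ := by
            apply ENNReal.ofReal_le_ofReal
            have h2 : Real.exp (((k + 1 : ℕ) + 2) * d * Real.log 2) = 2 ^ ((k + 1 + 2) * d) := by
              rw [mul_comm, Real.exp_mul, Real.exp_log two_pos, ← Real.rpow_natCast]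
              push_cast
              rfl
            rw [Real.exp_add, Real.exp_add, Real.exp_log two_pos, h2]
            have h3 : ((U (k + 1)).card : ℝ) ≤ 2 ^ ((k + 1 + 2) * d) := by
              exact_mod_cast hcard (k + 1)
            nlinarith [mul_le_mul_of_nonneg_right h3 (Real.exp_pos (4 * (s * lam ^ 2))).le]
  -- Telescoping along the links down to the root `0`: each link costs `lam / 2` times its
  -- increment, paid for by the term of its own level.
  have hdom : ∀ o m, ∀ u ∈ U m, lam / 2 * |ζ u o| ≤
      ∑ k ∈ Finset.range (m + 1), (1 / 2 : ℝ) ^ (k + 1) * Real.log (Q k o) := by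
    intro o m
    induction m with
    | zero =>
      intro u hu
      rw [hU0, Finset.mem_singleton] at hu
      subst hu
      have : lam * |ζ 0 o| ≤ Real.log (Q 0 o) := by
        rw [Real.le_log_iff_exp_le (hQpos 0 o)]
        simp only [hQ, if_true]
        exact exp_mul_abs_le _ _
      simp only [zero_add, Finset.sum_range_one]
      linarith
    | succ m ih =>
      intro u hu
      rw [Finset.sum_range_succ]
      have h1 := ih _ (hπU m u (hU _ u hu))
      have h2 : p (m + 1) * |Δ m u o| ≤ Real.log (Q (m + 1) o) := by
        rw [Real.le_log_iff_exp_le (hQpos _ o)]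
        simp only [hQ, if_neg (Nat.succ_ne_zero m), Nat.add_sub_cancel]
        refine (exp_mul_abs_le _ _).trans
          (Finset.single_le_sum (f := fun u => Real.exp (p (m + 1) * Δ m u o) +
            Real.exp (-p (m + 1) * Δ m u o)) (fun u _ => by positivity) hu)
      have h3 : lam / 2 * |Δ m u o| ≤ (1 / 2 : ℝ) ^ (m + 1 + 1) * Real.log (Q (m + 1) o) := by
        refine (le_of_eq ?_).trans (mul_le_mul_of_nonneg_left h2 (by positivity))
        simp only [hp, pow_succ, one_div, inv_pow]
        field_simp
      have h4 : |ζ u o| ≤ |ζ (π m u) o| + |Δ m u o| := by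
        have := abs_add_le (ζ (π m u) o) (Δ m u o)
        simpa [hΔ] using this
      nlinarith
  have hmain := measure_lt_sum_log_le Q B hQpos hQmeas hQint n
    (lam / 2 * y - (Real.log 2 + 2 * d * Real.log 2 + 5 / 2 * (s * lam ^ 2)))
  refine (measure_mono ?_).trans hmain
  rintro o ⟨u, hu, hyu⟩
  simp only [Set.mem_ofPred_eq]
  have h1 := hdom o n u hu
  have h2 := sum_chaining_exponents_le d (s * lam ^ 2) (by positivity) n
  have h3 : lam / 2 * y < lam / 2 * |ζ u o| := by gcongr
  refine lt_of_le_of_lt ?_ (h3.trans_le h1)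
  simp only [hB]
  linarith

/-- Uniform tail bound over the closed unit ball for finitely many continuous processes with
sub-Gaussian increments. -/
theorem exists_measurableSet_forall_abs_le [IsProbabilityMeasure μ] {E : Type*}
    [NormedAddCommGroup E] [NormedSpace ℝ E] [FiniteDimensional ℝ E] {ι : Type*} [Fintype ι]
    {ζ : ι → E → Ω → ℝ} {s lam : ℝ} (hs : 0 ≤ s) (hlam : 0 < lam)
    (hmeas : ∀ i u, ‖u‖ < 1 → AEMeasurable (ζ i u) μ)
    (hcont : ∀ i o, ContinuousOn (fun u => ζ i u o) (Metric.closedBall 0 1))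
    (hzero : ∀ i, ∀ t : ℝ, |t| ≤ lam →
      ∫⁻ o, ENNReal.ofReal (Real.exp (t * ζ i 0 o)) ∂μ ≤ ENNReal.ofReal (Real.exp (s * t ^ 2)))
    (hincr : ∀ i u v, ‖u‖ < 1 → ‖v‖ < 1 → ∀ t : ℝ, |t| * ‖u - v‖ ≤ 2 * lam →
      ∫⁻ o, ENNReal.ofReal (Real.exp (t * (ζ i u o - ζ i v o))) ∂μ ≤
        ENNReal.ofReal (Real.exp (s * (t * ‖u - v‖) ^ 2)))
    {y ε : ℝ}
    (hε : Fintype.card ι * Real.exp (-(lam / 2 * y - (Real.log 2 +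
      2 * Module.finrank ℝ E * Real.log 2 + 5 / 2 * (s * lam ^ 2)))) ≤ ε) :
    ∃ A : Set Ω, MeasurableSet A ∧ 1 - ε ≤ μ.real A ∧
      ∀ o ∈ A, ∀ i, ∀ u ∈ Metric.closedBall (0 : E) 1, |ζ i u o| ≤ y := by
  have hnet : ∀ n : ℕ, ∃ U : Finset E, (n = 0 → U = {0}) ∧ (∀ u ∈ U, ‖u‖ < 1) ∧
      (∀ x : E, ‖x‖ < 1 → ∃ c ∈ U, ‖x - c‖ < (1 / 2) ^ n) ∧
      U.card ≤ 2 ^ ((n + 2) * Module.finrank ℝ E) := by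
    intro n
    rcases n with _ | n
    · refine ⟨{0}, by simp, by simp, by simp, ?_⟩
      rw [Finset.card_singleton]
      exact Nat.one_le_two_pow
    · obtain ⟨U, h1, h2, h3⟩ := exists_net_unitBall (E := E) (r := (1 / 2) ^ (n + 1)) (by positivity)
      refine ⟨U, by simp, h1, h2, ?_⟩
      have h4 : (1 + 2 / (1 / 2 : ℝ) ^ (n + 1)) ≤ 2 ^ (n + 1 + 2) := by
        have h5 : (1 : ℝ) ≤ 2 ^ (n + 1) := one_le_pow₀ (by norm_num)
        rw [one_div, inv_pow, div_inv_eq_mul, pow_add 2 (n + 1) 2]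
        linarith
      have := h3.trans (pow_le_pow_left₀ (by positivity) h4 _)
      rw [← pow_mul] at this
      exact_mod_cast this
  choose U hU0 hU hcover hcard using hnet
  set bad : ℕ → Set Ω := fun n => {o | ∃ i, ∃ u ∈ U n, y < |ζ i u o|} with hbad
  have hε0 : 0 ≤ ε := le_trans (by positivity) hε
  have hbadle : ∀ n, μ (bad n) ≤ ENNReal.ofReal ε := by
    intro n
    have hun : bad n = ⋃ i, {o | ∃ u ∈ U n, y < |ζ i u o|} := by
      ext o; simp [hbad]
    rw [hun]
    refine (measure_iUnion_fintype_le _ _).trans ((Finset.sum_le_sum fun i _ =>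
      measure_exists_mem_net_lt_abs_le (Module.finrank ℝ E) hs hlam (hU0 0 rfl) hU hcover hcard
        (hmeas i) (hzero i) (hincr i) n y).trans ?_)
    rw [Finset.sum_const, nsmul_eq_mul, ← ENNReal.ofReal_natCast,
      ← ENNReal.ofReal_mul (by positivity), Finset.card_univ]
    exact ENNReal.ofReal_le_ofReal hε
  -- The nets are not nested, so the sets `bad n` need not be monotone. A violation at a point of
  -- the open ball persists nearby by continuity, hence occurs in all sufficiently fine nets; only
  -- the lower limit of the sets `bad n` must be excluded, and its measure is still at most `ε`.
  set V : Set Ω := ⋃ n, ⋂ m ≥ n, bad m with hV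
  have hmono : Monotone fun n => ⋂ m ≥ n, bad m := fun a b hab =>
    Set.biInter_subset_biInter_left fun m (hm : b ≤ m) => hab.trans hm
  have hVle : μ V ≤ ENNReal.ofReal ε := by
    rw [hV, hmono.measure_iUnion]
    exact iSup_le fun n => (measure_mono (Set.biInter_subset_of_mem le_rfl)).trans (hbadle n)
  refine ⟨(toMeasurable μ V)ᶜ, (measurableSet_toMeasurable μ V).compl, ?_, ?_⟩
  · rw [probReal_compl_eq_one_sub (measurableSet_toMeasurable μ V)]
    have : μ.real (toMeasurable μ V) ≤ ε := by
      rw [Measure.real, measure_toMeasurable]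
      exact ENNReal.toReal_le_of_le_ofReal hε0 hVle
    linarith
  · intro o ho i
    have hoV : o ∉ V := fun h => ho (subset_toMeasurable μ V h)
    simp only [hV, Set.mem_iUnion, Set.mem_iInter, not_exists, not_forall] at hoV
    have hball : ∀ u ∈ Metric.ball (0 : E) 1, |ζ i u o| ≤ y := by
      intro u hu
      by_contra! hlt
      have hc : ContinuousAt (fun u => |ζ i u o|) u :=
        ((hcont i o).continuousAt (Filter.mem_of_superset (Metric.isOpen_ball.mem_nhds hu)
          Metric.ball_subset_closedBall)).abs
      obtain ⟨δ, hδ, hδ'⟩ := Metric.eventually_nhds_iff.1 (hc.eventually (lt_mem_nhds hlt))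
      obtain ⟨n, hn⟩ := exists_pow_lt_of_lt_one hδ (by norm_num : (1 / 2 : ℝ) < 1)
      obtain ⟨m, hm, hom⟩ := hoV n
      obtain ⟨c, hcU, hc'⟩ := hcover m u (by simpa using hu)
      refine hom ⟨i, c, hcU, hδ' ?_⟩
      rw [dist_comm, dist_eq_norm]
      exact hc'.trans_le ((pow_le_pow_of_le_one (by norm_num) (by norm_num) hm).trans hn.le)
    intro u hu
    rw [← closure_ball (0 : E) one_ne_zero] at hu
    refine le_on_closure (f := fun u => |ζ i u o|) (g := fun _ => y) hball ?_ continuousOn_const hu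
    rw [closure_ball (0 : E) one_ne_zero]
    exact (hcont i o).abs

end Chaining

/-! ### Exponential moments of sums, of centred variables and of parameter averages. -/

section ExponentialMoments

variable {α : Type*} [MeasurableSpace α] {P : Measure α}

/-- The deviations of an average of independent copies inherit exponential moment bounds. -/
lemma lintegral_exp_sum_le {Ω : Type*} [MeasurableSpace Ω] {μ : Measure Ω}
    [IsProbabilityMeasure μ] {N : ℕ} {X : Fin N → Ω → α} (hX : iIndepFun X μ)
    (hlaw : ∀ i, HasLaw (X i) P μ) {D : α → ℝ} (hD : Measurable D) {r b : ℝ}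
    (h : ∫⁻ x, ENNReal.ofReal (Real.exp (r * D x)) ∂P ≤ ENNReal.ofReal (Real.exp b)) :
    ∫⁻ o, ENNReal.ofReal (Real.exp (r * ∑ i, D (X i o))) ∂μ ≤ ENNReal.ofReal (Real.exp (N * b)) := by
  -- `HasLaw` gives only almost everywhere measurability; the product formula is applied to
  -- measurable versions.
  set X' : Fin N → Ω → α := fun i => (hlaw i).aemeasurable.mk (X i) with hX'
  have hae : ∀ i, X i =ᵐ[μ] X' i := fun i => (hlaw i).aemeasurable.ae_eq_mk
  have hmeas : ∀ i, Measurable (X' i) := fun i => (hlaw i).aemeasurable.measurable_mk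
  have hlaw' : ∀ i, HasLaw (X' i) P μ := fun i => (hlaw i).congr (hae i).symm
  have hg : Measurable fun x => ENNReal.ofReal (Real.exp (r * D x)) := by fun_prop
  have hind : iIndepFun (fun i o => ENNReal.ofReal (Real.exp (r * D (X' i o)))) μ :=
    (hX.congr hae).comp (fun _ x => ENNReal.ofReal (Real.exp (r * D x))) fun _ => hg
  calc ∫⁻ o, ENNReal.ofReal (Real.exp (r * ∑ i, D (X i o))) ∂μ
      = ∫⁻ o, ∏ i, ENNReal.ofReal (Real.exp (r * D (X' i o))) ∂μ := by
        refine lintegral_congr_ae ?_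
        filter_upwards [ae_all_iff.2 hae] with o ho
        rw [← ENNReal.ofReal_prod_of_nonneg fun _ _ => by positivity, ← Real.exp_sum,
          Finset.mul_sum]
        simp only [ho]
    _ = ∏ i, ∫⁻ o, ENNReal.ofReal (Real.exp (r * D (X' i o))) ∂μ :=
        lintegral_prod_eq_prod_lintegral_of_indepFun _ _ hind fun i => hg.comp (hmeas i)
    _ ≤ ∏ _i : Fin N, ENNReal.ofReal (Real.exp b) := by
        refine Finset.prod_le_prod' fun i _ => ?_
        rw [(hlaw' i).lintegral_comp hg.aemeasurable]
        exact h
    _ = _ := by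
        rw [Finset.prod_const, ← ENNReal.ofReal_pow (by positivity), ← Real.exp_nat_mul]
        simp

lemma integrable_exp_mul_abs_of_lintegral_le {Y : α → ℝ} (hY : AEMeasurable Y P) {a : ℝ} {K : NNReal}
    (h : ∫⁻ x, ENNReal.ofReal (Real.exp (a * |Y x|)) ∂P ≤ K) :
    Integrable (fun x => Real.exp (a * |Y x|)) P ∧ ∫ x, Real.exp (a * |Y x|) ∂P ≤ K := by
  have hm : AEMeasurable (fun x => Real.exp (a * |Y x|)) P := by fun_prop
  refine ⟨⟨hm.aestronglyMeasurable, ?_⟩, ?_⟩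
  · rw [hasFiniteIntegral_iff_ofReal (Filter.Eventually.of_forall fun x => by positivity)]
    exact h.trans_lt ENNReal.coe_lt_top
  · rw [integral_eq_lintegral_of_nonneg_ae (Filter.Eventually.of_forall fun x => by positivity)
      hm.aestronglyMeasurable]
    exact ENNReal.toReal_le_coe_of_le_coe h

lemma abs_pow_le_exp {a : ℝ} (ha : 0 < a) (y : ℝ) (n : ℕ) :
    |y| ^ n ≤ (n.factorial / a ^ n) * Real.exp (a * |y|) := by
  have := Real.pow_div_factorial_le_exp (x := a * |y|) (by positivity) n
  rw [mul_pow, div_le_iff₀ (by positivity)] at this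
  rw [div_mul_eq_mul_div, le_div_iff₀ (by positivity)]
  linarith

lemma integrable_pow_of_lintegral_exp_le {Y : α → ℝ} (hY : AEMeasurable Y P) {a : ℝ} (ha : 0 < a)
    {K : NNReal} (h : ∫⁻ x, ENNReal.ofReal (Real.exp (a * |Y x|)) ∂P ≤ K) (n : ℕ) :
    Integrable (fun x => Y x ^ n) P := by
  refine (((integrable_exp_mul_abs_of_lintegral_le hY h).1).const_mul
    (n.factorial / a ^ n)).mono' (hY.pow_const n).aestronglyMeasurable
    (Filter.Eventually.of_forall fun x => ?_)
  rw [Real.norm_eq_abs, abs_pow]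
  exact abs_pow_le_exp ha _ _

lemma integrable_of_lintegral_exp_le {Y : α → ℝ} (hY : AEMeasurable Y P) {a : ℝ} (ha : 0 < a)
    {K : NNReal} (h : ∫⁻ x, ENNReal.ofReal (Real.exp (a * |Y x|)) ∂P ≤ K) : Integrable Y P := by
  simpa using integrable_pow_of_lintegral_exp_le hY ha h 1

lemma memLp_two_of_lintegral_exp_le {Y : α → ℝ} (hY : AEMeasurable Y P) {a : ℝ} (ha : 0 < a)
    {K : NNReal} (h : ∫⁻ x, ENNReal.ofReal (Real.exp (a * |Y x|)) ∂P ≤ K) : MemLp Y 2 P :=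
  (memLp_two_iff_integrable_sq hY.aestronglyMeasurable).2
    (integrable_pow_of_lintegral_exp_le hY ha h 2)

lemma abs_integral_le_of_lintegral_exp_le {Y : α → ℝ} (hY : AEMeasurable Y P) {a : ℝ} (ha : 0 < a)
    {K : NNReal} (h : ∫⁻ x, ENNReal.ofReal (Real.exp (a * |Y x|)) ∂P ≤ K) :
    |∫ x, Y x ∂P| ≤ K / a := by
  have h1 := integrable_exp_mul_abs_of_lintegral_le hY h
  calc |∫ x, Y x ∂P| ≤ ∫ x, |Y x| ∂P := abs_integral_le_integral_abs
    _ ≤ ∫ x, 1 / a * Real.exp (a * |Y x|) ∂P := by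
        refine integral_mono (integrable_of_lintegral_exp_le hY ha h).abs (h1.1.const_mul _)
          fun x => ?_
        simpa using abs_pow_le_exp ha (Y x) 1
    _ ≤ K / a := by
        rw [integral_const_mul, one_div_mul_eq_div]
        gcongr
        exact h1.2

/-- Third-order Taylor remainder, taken from the complex estimate. Keeping the quadratic term exact
lets the variance appear after integration. -/
lemma exp_le_quadratic_add_cubic (x : ℝ) :
    Real.exp x ≤ 1 + x + x ^ 2 / 2 + |x| ^ 3 * Real.exp |x| := by
  have h := Complex.norm_exp_sub_sum_le_norm_mul_exp (x : ℂ) 3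
  have h2 : Complex.exp (x : ℂ) - ∑ m ∈ Finset.range 3, (x : ℂ) ^ m / m.factorial =
      ((Real.exp x - (1 + x + x ^ 2 / 2) : ℝ) : ℂ) := by
    simp [Finset.sum_range_succ]
  rw [h2, Complex.norm_real, Complex.norm_real, Real.norm_eq_abs, Real.norm_eq_abs] at h
  linarith [le_abs_self (Real.exp x - (1 + x + x ^ 2 / 2))]

/-- Random variables with variance at most `v` and a uniformly bounded exponential moment are
uniformly sub-Gaussian near the origin. -/
theorem exists_forall_lintegral_exp_centered_le [IsProbabilityMeasure P] {a : ℝ} (ha : 0 < a)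
    (K : NNReal) (v : ℝ) :
    ∃ τ : ℝ, 0 < τ ∧ ∀ Y : α → ℝ, AEMeasurable Y P →
      ∫⁻ x, ENNReal.ofReal (Real.exp (a * |Y x|)) ∂P ≤ K → variance Y P ≤ v →
      ∀ t : ℝ, |t| ≤ τ → ∫⁻ x, ENNReal.ofReal (Real.exp (t * (Y x - ∫ z, Y z ∂P))) ∂P ≤
        ENNReal.ofReal (Real.exp (v * t ^ 2)) := by
  -- For `v ≤ 0` no quadratic slack is available to absorb a cubic error, but then `v = 0` and `Y`
  -- is almost surely constant.
  rcases le_or_gt v 0 with hv | hv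
  · refine ⟨1, one_pos, fun Y hY hK hvar t _ => ?_⟩
    have h0 : variance Y P = 0 := le_antisymm (hvar.trans hv) (variance_nonneg Y P)
    have hv0 : v = 0 := le_antisymm hv (h0 ▸ hvar)
    have hfin := (memLp_two_of_lintegral_exp_le hY ha hK).evariance_lt_top
    have hE : evariance Y P = 0 := by
      rw [variance, ENNReal.toReal_eq_zero_iff] at h0
      exact h0.resolve_right hfin.ne
    rw [evariance_eq_zero_iff hY] at hE
    have : ∫⁻ x, ENNReal.ofReal (Real.exp (t * (Y x - ∫ z, Y z ∂P))) ∂P = ∫⁻ _, 1 ∂P := by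
      refine lintegral_congr_ae ?_
      filter_upwards [hE] with x hx
      simp [hx]
    rw [this, hv0]
    simp
  -- Here `48 / a ^ 3 = 3! / (a / 2) ^ 3` bounds the cube by an exponential, `exp K` pays for the
  -- centring since `a |M| ≤ K`, and the last `K` bounds the exponential moment.
  · set C : ℝ := 48 / a ^ 3 * Real.exp K * K with hC
    have hC0 : 0 ≤ C := by positivity
    -- The first bound leaves half of the exponent `a` for the cube. The second makes the cubic term
    -- at most `v t ^ 2 / 2`, exactly the gap between the Taylor coefficient `v / 2` and the claimed
    -- `v`.
    refine ⟨min (a / 2) (v / (2 * (C + 1))), by positivity, fun Y hY hK hvar t ht => ?_⟩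
    have ht1 : |t| ≤ a / 2 := ht.trans (min_le_left _ _)
    have ht2 : |t| ≤ v / (2 * (C + 1)) := ht.trans (min_le_right _ _)
    set M := ∫ z, Y z ∂P with hM
    have hMle : |M| ≤ K / a := abs_integral_le_of_lintegral_exp_le hY ha hK
    have hexp := integrable_exp_mul_abs_of_lintegral_le hY hK
    have hL2 := memLp_two_of_lintegral_exp_le hY ha hK
    have hint := integrable_of_lintegral_exp_le hY ha hK
    set g : α → ℝ := fun x => 1 + t * (Y x - M) + t ^ 2 / 2 * (Y x - M) ^ 2 +
      |t| ^ 3 * (48 / a ^ 3 * Real.exp K) * Real.exp (a * |Y x|) with hg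
    have hle : ∀ x, Real.exp (t * (Y x - M)) ≤ g x := by
      intro x
      have h1 := exp_le_quadratic_add_cubic (t * (Y x - M))
      have h2 : |t * (Y x - M)| ^ 3 * Real.exp |t * (Y x - M)| ≤
          |t| ^ 3 * (48 / a ^ 3 * Real.exp K) * Real.exp (a * |Y x|) := by
        have h3 := abs_pow_le_exp (half_pos ha) (Y x - M) 3
        have h4 : Real.exp |t * (Y x - M)| ≤ Real.exp (a / 2 * |Y x - M|) := by
          rw [abs_mul]; gcongr
        have h5 : |Y x - M| ≤ |Y x| + K / a := (abs_sub _ _).trans (by linarith)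
        have h6 : a * |Y x - M| ≤ K + a * |Y x| := by
          calc a * |Y x - M| ≤ a * (|Y x| + K / a) := by gcongr
            _ = K + a * |Y x| := by field_simp; ring
        calc |t * (Y x - M)| ^ 3 * Real.exp |t * (Y x - M)|
            ≤ |t| ^ 3 * (((3 : ℕ).factorial / (a / 2) ^ 3) * Real.exp (a / 2 * |Y x - M|)) *
              Real.exp (a / 2 * |Y x - M|) := by
              rw [abs_mul, mul_pow, ← abs_mul]
              gcongr
          _ = |t| ^ 3 * (48 / a ^ 3) * Real.exp (a * |Y x - M|) := by
              have : Real.exp (a * |Y x - M|) =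
                  Real.exp (a / 2 * |Y x - M|) * Real.exp (a / 2 * |Y x - M|) := by
                rw [← Real.exp_add]; ring_nf
              rw [this]
              simp [Nat.factorial]
              ring
          _ ≤ |t| ^ 3 * (48 / a ^ 3) * (Real.exp K * Real.exp (a * |Y x|)) := by
              rw [← Real.exp_add]; gcongr
          _ = _ := by ring
      simp only [hg]
      nlinarith
    have hsq : Integrable (fun x => (Y x - M) ^ 2) P :=
      (hL2.sub (memLp_const M)).integrable_sq
    have hgint : Integrable g P :=
      (((integrable_const _).add ((hint.sub (integrable_const M)).const_mul t)).add
        (hsq.const_mul _)).add (hexp.1.const_mul _)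
    have hcent : ∫ x, (Y x - M) ∂P = 0 := by
      rw [integral_sub hint (integrable_const M)]
      simp [hM]
    have hgval : ∫ x, g x ∂P = 1 + t ^ 2 / 2 * variance Y P +
        |t| ^ 3 * (48 / a ^ 3 * Real.exp K) * ∫ x, Real.exp (a * |Y x|) ∂P := by
      simp only [hg]
      rw [integral_add, integral_add, integral_add, integral_const_mul, integral_const_mul,
        integral_const_mul, hcent, variance_eq_integral hY]
      · simp [← hM]
      · exact integrable_const _
      · exact (hint.sub (integrable_const M)).const_mul t
      · exact (integrable_const _).add ((hint.sub (integrable_const M)).const_mul t)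
      · exact hsq.const_mul _
      · exact ((integrable_const _).add ((hint.sub (integrable_const M)).const_mul t)).add
          (hsq.const_mul _)
      · exact hexp.1.const_mul _
    have hgle : ∫ x, g x ∂P ≤ Real.exp (v * t ^ 2) := by
      have h1 : |t| ^ 3 * (48 / a ^ 3 * Real.exp K) * ∫ x, Real.exp (a * |Y x|) ∂P ≤
          |t| ^ 3 * C := by
        calc _ ≤ |t| ^ 3 * (48 / a ^ 3 * Real.exp K) * K := by gcongr; exact hexp.2
          _ = |t| ^ 3 * C := by rw [hC]; ring
      have h2 : |t| * C ≤ v / 2 := by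
        rw [le_div_iff₀ (by positivity)] at ht2
        nlinarith [abs_nonneg t]
      have h3 : |t| ^ 3 * C ≤ v / 2 * t ^ 2 := by
        calc |t| ^ 3 * C = |t| ^ 2 * (|t| * C) := by ring
          _ ≤ |t| ^ 2 * (v / 2) := by gcongr
          _ = _ := by rw [sq_abs]; ring
      have h4 : t ^ 2 / 2 * variance Y P ≤ t ^ 2 / 2 * v := by gcongr
      have h5 := Real.add_one_le_exp (v * t ^ 2)
      rw [hgval]
      linarith
    calc _ ≤ ∫⁻ x, ENNReal.ofReal (g x) ∂P :=
          lintegral_mono fun x => ENNReal.ofReal_le_ofReal (hle x)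
      _ = ENNReal.ofReal (∫ x, g x ∂P) :=
          (ofReal_integral_eq_lintegral_ofReal hgint
            (Filter.Eventually.of_forall fun x => (Real.exp_pos _).le.trans (hle x))).symm
      _ ≤ _ := ENNReal.ofReal_le_ofReal hgle

/-- Jensen's inequality and Tonelli: averaging over a parameter preserves exponential moment
bounds. -/
lemma lintegral_exp_integral_le [IsProbabilityMeasure P] {β : Type*} [MeasurableSpace β]
    {ν : Measure β} [IsProbabilityMeasure ν] {h : α → β → ℝ} (hmeas : Measurable (Function.uncurry h))
    (hbdd : ∀ x, ∃ C, ∀ᵐ s ∂ν, |h x s| ≤ C) {t : ℝ} {b : ENNReal}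
    (hle : ∀ᵐ s ∂ν, ∫⁻ x, ENNReal.ofReal (Real.exp (t * h x s)) ∂P ≤ b) :
    ∫⁻ x, ENNReal.ofReal (Real.exp (t * ∫ s, h x s ∂ν)) ∂P ≤ b := by
  have hE : Measurable fun p : α × β => ENNReal.ofReal (Real.exp (t * h p.1 p.2)) := by
    have : Measurable fun p : α × β => h p.1 p.2 := hmeas
    fun_prop
  have hx : ∀ x, ENNReal.ofReal (Real.exp (t * ∫ s, h x s ∂ν)) ≤
      ∫⁻ s, ENNReal.ofReal (Real.exp (t * h x s)) ∂ν := by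
    intro x
    obtain ⟨C, hC⟩ := hbdd x
    have hm : Measurable (h x) := hmeas.comp measurable_prodMk_left
    have hi : Integrable (fun s => t * h x s) ν :=
      (Integrable.of_bound hm.aestronglyMeasurable C hC).const_mul t
    have hei : Integrable (fun s => Real.exp (t * h x s)) ν := by
      refine Integrable.of_bound (by fun_prop) (Real.exp (|t| * C)) ?_
      filter_upwards [hC] with s hs
      rw [Real.norm_eq_abs, abs_of_pos (Real.exp_pos _), Real.exp_le_exp]
      calc t * h x s ≤ |t * h x s| := le_abs_self _
        _ = |t| * |h x s| := abs_mul _ _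
        _ ≤ |t| * C := by gcongr
    have hJ := convexOn_exp.map_integral_le Real.continuous_exp.continuousOn isClosed_univ
      (Filter.Eventually.of_forall fun s => Set.mem_univ _) hi hei
    rw [integral_const_mul] at hJ
    rw [← ofReal_integral_eq_lintegral_ofReal hei
      (Filter.Eventually.of_forall fun s => (Real.exp_pos _).le)]
    exact ENNReal.ofReal_le_ofReal hJ
  calc _ ≤ ∫⁻ x, ∫⁻ s, ENNReal.ofReal (Real.exp (t * h x s)) ∂ν ∂P := lintegral_mono hx
    _ = ∫⁻ s, ∫⁻ x, ENNReal.ofReal (Real.exp (t * h x s)) ∂P ∂ν :=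
        lintegral_lintegral_swap hE.aemeasurable
    _ ≤ ∫⁻ _, b ∂ν := lintegral_mono_ae hle
    _ = b := by simp

end ExponentialMoments

/-! ### Increments in the parameter and empirical processes. -/

section Increments

variable {α : Type*} [MeasurableSpace α] {P : Measure α} {E : Type*} [NormedAddCommGroup E]
  [InnerProductSpace ℝ E] [CompleteSpace E] {Y : α → E → ℝ} {G : α → E → E}

lemma HasGradientAt.hasDerivAt_comp_line {f : E → ℝ} {g w v : E} {s : ℝ}
    (h : HasGradientAt f g (w + s • v)) :
    HasDerivAt (fun r : ℝ => f (w + r • v)) (inner ℝ g v) s := by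
  have h1 : HasDerivAt (fun r : ℝ => w + r • v) v s := by
    simpa using ((hasDerivAt_id s).smul_const v).const_add w
  have h2 := HasFDerivAt.comp_hasDerivAt s h.hasFDerivAt h1
  simpa [Function.comp_def] using h2

/-- The gradient in the parameter of a measurable family is measurable. -/
lemma measurable_inner_gradient (hY : ∀ w : E, ‖w‖ < 1 → Measurable fun x => Y x w)
    (hgrad : ∀ x, ∀ w : E, ‖w‖ < 1 → HasGradientAt (Y x) (G x w) w) {w : E} (hw : ‖w‖ < 1) (v : E) :
    Measurable fun x => inner ℝ (G x w) v := by
  classical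
  have ht : Filter.Tendsto (fun n : ℕ => 1 / ((n : ℝ) + 1)) Filter.atTop (nhdsWithin 0 {0}ᶜ) := by
    refine tendsto_nhdsWithin_iff.2 ⟨tendsto_one_div_add_atTop_nhds_zero_nat,
      Filter.Eventually.of_forall fun n => ?_⟩
    have : (0 : ℝ) < 1 / ((n : ℝ) + 1) := by positivity
    exact this.ne'
  -- The gradient is a limit of difference quotients; the guard discards the steps leaving the ball,
  -- where measurability of `Y` is not assumed.
  refine measurable_of_tendsto_metrizable (f := fun (n : ℕ) x =>
    if ‖w + (1 / ((n : ℝ) + 1)) • v‖ < 1 then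
      (1 / ((n : ℝ) + 1))⁻¹ * (Y x (w + (1 / ((n : ℝ) + 1)) • v) - Y x w) else 0) ?_ ?_
  · intro n
    by_cases h : ‖w + (1 / ((n : ℝ) + 1)) • v‖ < 1
    · simp only [if_pos h]
      exact ((hY _ h).sub (hY _ hw)).const_mul _
    · simp only [if_neg h]
      exact measurable_const
  · rw [tendsto_pi_nhds]
    intro x
    have h1 : HasDerivAt (fun r : ℝ => Y x (w + r • v)) (inner ℝ (G x w) v) 0 :=
      HasGradientAt.hasDerivAt_comp_line (by simpa using hgrad x w hw)
    have h2 := h1.tendsto_slope_zero.comp ht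
    refine h2.congr' ?_
    have h3 : Filter.Tendsto (fun r : ℝ => ‖w + r • v‖) (nhdsWithin 0 {0}ᶜ) (nhds ‖w‖) := by
      have : Continuous fun r : ℝ => ‖w + r • v‖ := by fun_prop
      simpa using (this.tendsto 0).mono_left nhdsWithin_le_nhds
    filter_upwards [(h3.comp ht).eventually (gt_mem_nhds hw)] with n hn
    simp only [Function.comp_apply] at hn ⊢
    rw [if_pos hn]
    simp

/-- Exponential moment bound for the centred increments, and `L¹` Lipschitz bound, for a
differentiable family whose gradient has bounded covariance and a uniform exponential moment. -/
theorem exists_forall_lintegral_exp_increment_le [IsProbabilityMeasure P]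
    (hY : ∀ w : E, ‖w‖ < 1 → Measurable fun x => Y x w)
    (hgrad : ∀ x, ∀ w : E, ‖w‖ < 1 → HasGradientAt (Y x) (G x w) w)
    (hcont : ∀ x, ContinuousOn (G x) (Metric.ball 0 1))
    (hint : ∀ w : E, ‖w‖ < 1 → Integrable (fun x => Y x w) P)
    {a : ℝ} (ha : 0 < a) {K : NNReal}
    (hexp : ∀ w : E, ‖w‖ < 1 → ∫⁻ x, ENNReal.ofReal (Real.exp (a * ‖G x w‖)) ∂P ≤ K) {v : ℝ}
    (hvar : ∀ w : E, ‖w‖ < 1 → ∀ e : E, ‖e‖ ≤ 1 →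
      variance (fun x => inner ℝ (G x w) e) P ≤ v) :
    ∃ τ : ℝ, 0 < τ ∧ ∀ u w : E, ‖u‖ < 1 → ‖w‖ < 1 →
      ∫ x, |Y x u - Y x w| ∂P ≤ ‖u - w‖ * (K / a) ∧ ∀ t : ℝ, |t| * ‖u - w‖ ≤ τ →
      ∫⁻ x, ENNReal.ofReal (Real.exp
        (t * ((Y x u - ∫ z, Y z u ∂P) - (Y x w - ∫ z, Y z w ∂P)))) ∂P ≤
        ENNReal.ofReal (Real.exp (v * (t * ‖u - w‖) ^ 2)) := by
  obtain ⟨τ, hτ, hmgf⟩ := exists_forall_lintegral_exp_centered_le (P := P) ha K v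
  refine ⟨τ, hτ, fun u w hu hw => ?_⟩
  set e : E := u - w with he
  -- For `e = 0` this is `0`, so only `‖e1‖ ≤ 1` is available, which suffices.
  set e1 : E := ‖e‖⁻¹ • e with he1
  have he1n : ‖e1‖ ≤ 1 := by
    rw [he1, norm_smul, norm_inv, norm_norm]
    exact inv_mul_le_one
  have hee1 : e = ‖e‖ • e1 := by
    rcases eq_or_ne e 0 with h | h
    · simp [h]
    · rw [he1, smul_smul, mul_inv_cancel₀ (norm_ne_zero_iff.2 h), one_smul]
  -- Clamping to `[0, 1]` keeps the path inside the ball for every real `s`, so continuity and joint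
  -- measurability hold on all of `ℝ`.
  set c : ℝ → ℝ := fun s => max 0 (min 1 s) with hc
  have hcc : Continuous c := by fun_prop
  have hc01 : ∀ s, c s ∈ Set.Icc (0 : ℝ) 1 := fun s =>
    ⟨le_max_left _ _, max_le zero_le_one (min_le_left _ _)⟩
  have hcid : ∀ s ∈ Set.Icc (0 : ℝ) 1, c s = s := fun s hs => by
    simp [hc, min_eq_right hs.2, max_eq_right hs.1]
  have hseg : ∀ s ∈ Set.Icc (0 : ℝ) 1, ‖w + s • e‖ < 1 := by
    intro s hs
    have h1 : w + s • e ∈ Metric.ball (0 : E) 1 := by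
      refine (convex_ball (0 : E) 1).add_smul_sub_mem ?_ ?_ hs <;> simpa
    simpa using h1
  have hGm : ∀ s, Measurable fun x => inner ℝ (G x (w + c s • e)) e := fun s =>
    measurable_inner_gradient hY hgrad (hseg _ (hc01 s)) e
  have hGc : ∀ x, Continuous fun s => inner ℝ (G x (w + c s • e)) e := by
    intro x
    have h1 : Continuous fun s => G x (w + c s • e) :=
      (hcont x).comp_continuous (by fun_prop) fun s => by simpa using hseg _ (hc01 s)
    exact h1.inner continuous_const
  set m : ℝ → ℝ := fun s => ∫ z, inner ℝ (G z (w + c s • e)) e ∂P with hm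
  have hjoint : Measurable (Function.uncurry fun x s => inner ℝ (G x (w + c s • e)) e) := by
    have := measurable_uncurry_of_continuous_of_measurable hGc hGm
    exact this.comp measurable_swap
  have hmm : Measurable m :=
    hjoint.stronglyMeasurable.integral_prod_left'.measurable
  have hE1 : ∀ s, ∫⁻ x, ENNReal.ofReal (Real.exp (a * |inner ℝ (G x (w + c s • e)) e1|)) ∂P ≤ K := by
    intro s
    refine le_trans (lintegral_mono fun x => ?_) (hexp _ (hseg _ (hc01 s)))
    apply ENNReal.ofReal_le_ofReal
    have h1 : |inner ℝ (G x (w + c s • e)) e1| ≤ ‖G x (w + c s • e)‖ :=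
      (abs_real_inner_le_norm _ _).trans (mul_le_of_le_one_right (norm_nonneg _) he1n)
    gcongr
  have hG1m : ∀ s, AEMeasurable (fun x => inner ℝ (G x (w + c s • e)) e1) P := fun s =>
    (measurable_inner_gradient hY hgrad (hseg _ (hc01 s)) e1).aemeasurable
  have hee : ∀ x s, inner ℝ (G x (w + c s • e)) e = ‖e‖ * inner ℝ (G x (w + c s • e)) e1 := by
    intro x s
    conv_lhs => rw [hee1]
    rw [real_inner_smul_right, ← hee1]
  have hmb : ∀ s, |m s| ≤ ‖e‖ * (K / a) := by
    intro s
    simp only [hm, hee, integral_const_mul, abs_mul, abs_norm]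
    gcongr
    exact abs_integral_le_of_lintegral_exp_le (hG1m s) ha (hE1 s)
  set ν : Measure ℝ := volume.restrict (Set.Icc 0 1) with hν
  have : IsProbabilityMeasure ν := ⟨by simp [hν]⟩
  have hbd : ∀ x, ∃ C, ∀ᵐ s ∂ν, |inner ℝ (G x (w + c s • e)) e - m s| ≤ C := by
    intro x
    obtain ⟨C, hC⟩ := isCompact_Icc.exists_bound_of_continuousOn
      (s := Set.Icc (0 : ℝ) 1) (hGc x).continuousOn
    refine ⟨C + ‖e‖ * (K / a), ae_restrict_of_forall_mem measurableSet_Icc fun s hs => ?_⟩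
    exact (abs_sub _ _).trans (add_le_add (hC s hs) (hmb s))
  have hIcc : ∀ g : ℝ → ℝ, ∫ s, g s ∂ν = ∫ s in (0 : ℝ)..1, g s := fun g => by
    rw [hν, intervalIntegral.integral_of_le zero_le_one, integral_Icc_eq_integral_Ioc]
  have hGi : ∀ x, Integrable (fun s => inner ℝ (G x (w + c s • e)) e) ν := fun x =>
    (hGc x).continuousOn.integrableOn_compact isCompact_Icc
  have hmi : Integrable m ν :=
    Integrable.of_bound hmm.aestronglyMeasurable (‖e‖ * (K / a)) (Filter.Eventually.of_forall hmb)
  have hftc : ∀ x, ∫ s, inner ℝ (G x (w + c s • e)) e ∂ν = Y x u - Y x w := by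
    intro x
    rw [hIcc, intervalIntegral.integral_eq_sub_of_hasDerivAt (f := fun r : ℝ => Y x (w + r • e))]
    · simp [he]
    · intro s hs
      rw [Set.uIcc_of_le zero_le_one] at hs
      rw [hcid s hs]
      exact (hgrad x _ (hseg s hs)).hasDerivAt_comp_line
    · exact (hGc x).intervalIntegrable _ _
  have hbound : ∀ s, ∫ x, ‖inner ℝ (G x (w + c s • e)) e‖ ∂P ≤ ‖e‖ * (K / a) := by
    intro s
    have h1 := abs_integral_le_of_lintegral_exp_le (Y := fun x => |inner ℝ (G x (w + c s • e)) e1|)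
      (hG1m s).abs ha (by simpa only [abs_abs] using hE1 s)
    simp only [hee, norm_mul, Real.norm_eq_abs, integral_const_mul, abs_norm]
    exact mul_le_mul_of_nonneg_left ((le_abs_self _).trans h1) (norm_nonneg _)
  -- Justifies Fubini, by which the mean of the increment is the average over the segment of the
  -- mean directional derivatives.
  have hprod : Integrable (Function.uncurry fun x s => inner ℝ (G x (w + c s • e)) e)
      (P.prod ν) := by
    rw [integrable_prod_iff' hjoint.aestronglyMeasurable]
    refine ⟨Filter.Eventually.of_forall fun s => ?_, ?_⟩
    · simp only [Function.uncurry_apply_pair, hee]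
      exact (integrable_of_lintegral_exp_le (hG1m s) ha (hE1 s)).const_mul _
    · refine Integrable.of_bound (C := ‖e‖ * (K / a)) ?_ (Filter.Eventually.of_forall fun s => ?_)
      · exact hjoint.norm.stronglyMeasurable.integral_prod_left'.aestronglyMeasurable
      · rw [Real.norm_of_nonneg (integral_nonneg fun _ => norm_nonneg _)]
        exact hbound s
  have hmint : ∫ s, m s ∂ν = (∫ z, Y z u ∂P) - ∫ z, Y z w ∂P := by
    rw [← integral_sub (hint u hu) (hint w hw)]
    simp only [hm, ← hftc]
    exact (integral_integral_swap hprod).symm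
  refine ⟨?_, fun t ht => ?_⟩
  · calc ∫ x, |Y x u - Y x w| ∂P ≤ ∫ x, ∫ s, ‖inner ℝ (G x (w + c s • e)) e‖ ∂ν ∂P := by
          refine integral_mono ((hint u hu).sub (hint w hw)).abs hprod.norm.integral_prod_left
            fun x => ?_
          simp only [← hftc]
          exact abs_integral_le_integral_abs
      _ = ∫ s, ∫ x, ‖inner ℝ (G x (w + c s • e)) e‖ ∂P ∂ν := integral_integral_swap hprod.norm
      _ ≤ ∫ _, ‖e‖ * (K / a) ∂ν :=
          integral_mono hprod.norm.integral_prod_right (integrable_const _) hbound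
      _ = ‖e‖ * (K / a) := by simp
  -- The centred increment is the average over the segment of centred directional derivatives, each
  -- sub-Gaussian at parameter `t ‖e‖` in direction `e1`.
  have hstep := lintegral_exp_integral_le (P := P) (ν := ν) (t := t)
    (h := fun x s => inner ℝ (G x (w + c s • e)) e - m s)
    (b := ENNReal.ofReal (Real.exp (v * (t * ‖e‖) ^ 2)))
    (hjoint.sub (hmm.comp measurable_snd)) hbd (Filter.Eventually.of_forall fun s => by
      have h1 := hmgf _ (hG1m s) (hE1 s) (hvar _ (hseg _ (hc01 s)) e1 he1n) (t * ‖e‖)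
        (by rwa [abs_mul, abs_norm])
      refine le_trans (le_of_eq (lintegral_congr fun x => ?_)) h1
      simp only [hm, hee, integral_const_mul]
      ring_nf)
  refine le_trans (le_of_eq (lintegral_congr fun x => ?_)) hstep
  rw [integral_sub (hGi x) hmi, hftc, hmint]
  ring_nf

/-- A family of random variables, continuously differentiable in a parameter that ranges over the
closed unit ball, with uniform exponential moments and with variances bounded by `v`. -/
structure SubexponentialFamily (P : Measure α) (Y : α → E → ℝ) (G : α → E → E) (v : ℝ) : Prop where
  measurable : ∀ w : E, ‖w‖ ≤ 1 → Measurable fun x => Y x w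
  continuousOn : ∀ x, ContinuousOn (Y x) (Metric.closedBall 0 1)
  hasGradientAt : ∀ x, ∀ w : E, ‖w‖ < 1 → HasGradientAt (Y x) (G x w) w
  continuousOn_gradient : ∀ x, ContinuousOn (G x) (Metric.ball 0 1)
  expMoment : ∃ a : ℝ, 0 < a ∧ ∃ K : NNReal, ∀ w : E, ‖w‖ ≤ 1 →
    ∫⁻ x, ENNReal.ofReal (Real.exp (a * |Y x w|)) ∂P ≤ K
  expMoment_gradient : ∃ a : ℝ, 0 < a ∧ ∃ K : NNReal, ∀ w : E, ‖w‖ < 1 →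
    ∫⁻ x, ENNReal.ofReal (Real.exp (a * ‖G x w‖)) ∂P ≤ K
  variance_le : variance (fun x => Y x 0) P ≤ v
  variance_gradient_le : ∀ w : E, ‖w‖ < 1 → ∀ e : E, ‖e‖ ≤ 1 →
    variance (fun x => inner ℝ (G x w) e) P ≤ v

namespace SubexponentialFamily

variable {v : ℝ}

lemma integrable (h : SubexponentialFamily P Y G v) {w : E} (hw : ‖w‖ ≤ 1) :
    Integrable (fun x => Y x w) P := by
  obtain ⟨a, ha, K, hK⟩ := h.expMoment
  exact integrable_of_lintegral_exp_le (h.measurable w hw).aemeasurable ha (hK w hw)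

lemma nonneg (h : SubexponentialFamily P Y G v) : 0 ≤ v :=
  (variance_nonneg _ _).trans h.variance_le

lemma exists_forall_increment [IsProbabilityMeasure P] (h : SubexponentialFamily P Y G v) :
    ∃ τ : ℝ, 0 < τ ∧ ∃ C : ℝ, ∀ u w : E, ‖u‖ < 1 → ‖w‖ < 1 →
      ∫ x, |Y x u - Y x w| ∂P ≤ ‖u - w‖ * C ∧ ∀ t : ℝ, |t| * ‖u - w‖ ≤ τ →
      ∫⁻ x, ENNReal.ofReal (Real.exp
        (t * ((Y x u - ∫ z, Y z u ∂P) - (Y x w - ∫ z, Y z w ∂P)))) ∂P ≤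
        ENNReal.ofReal (Real.exp (v * (t * ‖u - w‖) ^ 2)) := by
  obtain ⟨a, ha, K, hK⟩ := h.expMoment_gradient
  obtain ⟨τ, hτ, H⟩ := exists_forall_lintegral_exp_increment_le (P := P)
    (fun w hw => h.measurable w hw.le) h.hasGradientAt h.continuousOn_gradient
    (fun w hw => h.integrable hw.le) ha hK h.variance_gradient_le
  exact ⟨τ, hτ, K / a, H⟩

/-- The means are Lipschitz, which makes the centred processes continuous up to the sphere. The
increment bound is known only in the open ball and reaches the boundary by radial approximation. -/
lemma continuousOn_integral [IsProbabilityMeasure P] (h : SubexponentialFamily P Y G v) :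
    ContinuousOn (fun w => ∫ x, Y x w ∂P) (Metric.closedBall 0 1) := by
  obtain ⟨τ, -, C, H⟩ := h.exists_forall_increment
  have key : ∀ u ∈ Metric.closedBall (0 : E) 1, ∀ w ∈ Metric.closedBall (0 : E) 1,
      ‖(∫ x, Y x u ∂P) - ∫ x, Y x w ∂P‖ ≤ ‖u - w‖ * |C| := by
    intro u hu w hw
    have hu' : ‖u‖ ≤ 1 := by simpa using hu
    have hw' : ‖w‖ ≤ 1 := by simpa using hw
    set r : ℕ → ℝ := fun n => 1 - 1 / ((n : ℝ) + 1) with hr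
    have hr0 : ∀ n, 0 ≤ r n := fun n => by
      rw [hr, sub_nonneg, div_le_one (by positivity)]
      linarith [(Nat.cast_nonneg n : (0 : ℝ) ≤ n)]
    have hr1 : ∀ n, r n < 1 := fun n => sub_lt_self _ (by positivity)
    have hlim : Filter.Tendsto r Filter.atTop (nhds 1) := by
      simpa [hr] using tendsto_one_div_add_atTop_nhds_zero_nat.const_sub (1 : ℝ)
    have hin : ∀ z : E, ‖z‖ ≤ 1 → ∀ n, ‖r n • z‖ < 1 := fun z hz n => by
      rw [norm_smul, Real.norm_of_nonneg (hr0 n)]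
      exact (mul_le_of_le_one_right (hr0 n) hz).trans_lt (hr1 n)
    have hconv : ∀ x, ∀ z : E, ‖z‖ ≤ 1 →
        Filter.Tendsto (fun n => Y x (r n • z)) Filter.atTop (nhds (Y x z)) := by
      intro x z hz
      have h1 : Filter.Tendsto (fun n => r n • z) Filter.atTop
          (nhdsWithin z (Metric.closedBall 0 1)) := by
        refine tendsto_nhdsWithin_iff.2 ⟨by simpa using hlim.smul_const z,
          Filter.Eventually.of_forall fun n => by simpa using (hin z hz n).le⟩
      exact Filter.Tendsto.comp (h.continuousOn x z (by simpa using hz)) h1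
    -- Fatou's lemma along `r n • u` and `r n • w` needs no dominating function.
    have hfat : ∫⁻ x, ENNReal.ofReal |Y x u - Y x w| ∂P ≤ ENNReal.ofReal (‖u - w‖ * |C|) := by
      have hl : ∀ x, ENNReal.ofReal |Y x u - Y x w| = Filter.liminf
          (fun n => ENNReal.ofReal |Y x (r n • u) - Y x (r n • w)|) Filter.atTop := fun x =>
        (Filter.Tendsto.liminf_eq (ENNReal.tendsto_ofReal
          ((hconv x u hu').sub (hconv x w hw')).abs)).symm
      simp_rw [hl]
      refine (lintegral_liminf_le fun n => ?_).trans ?_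
      · have h1 := h.measurable _ (hin u hu' n).le
        have h2 := h.measurable _ (hin w hw' n).le
        exact (measurable_norm.comp (h1.sub h2)).ennreal_ofReal
      · refine Filter.liminf_le_of_le (by isBoundedDefault) fun b hb => ?_
        obtain ⟨n, hn⟩ := hb.exists
        refine hn.trans ?_
        have hab : Integrable (fun x => |Y x (r n • u) - Y x (r n • w)|) P :=
          ((h.integrable (hin u hu' n).le).sub (h.integrable (hin w hw' n).le)).abs
        rw [← ofReal_integral_eq_lintegral_ofReal hab
          (Filter.Eventually.of_forall fun _ => abs_nonneg _)]
        apply ENNReal.ofReal_le_ofReal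
        refine (H _ _ (hin u hu' n) (hin w hw' n)).1.trans ?_
        rw [← smul_sub, norm_smul, Real.norm_of_nonneg (hr0 n)]
        exact (mul_le_mul_of_nonneg_left (le_abs_self C) (mul_nonneg (hr0 n) (norm_nonneg _))).trans
          (mul_le_mul_of_nonneg_right (mul_le_of_le_one_left (norm_nonneg _) (hr1 n).le)
            (abs_nonneg C))
    rw [← integral_sub (h.integrable hu') (h.integrable hw')]
    refine (norm_integral_le_lintegral_norm _).trans ?_
    exact ENNReal.toReal_le_of_le_ofReal (by positivity) hfat
  refine (LipschitzOnWith.of_dist_le_mul (K := ⟨|C|, abs_nonneg C⟩) fun u hu w hw => ?_).continuousOn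
  rw [dist_eq_norm, dist_eq_norm, mul_comm]
  exact key u hu w hw

end SubexponentialFamily

/-- Uniform deviation bound for finitely many empirical processes indexed by the unit ball. -/
theorem exists_forall_empirical_deviation_le [IsProbabilityMeasure P] [FiniteDimensional ℝ E]
    {ι : Type*} [Fintype ι] {Y : ι → α → E → ℝ} {G : ι → α → E → E} {v : ℝ}
    (h : ∀ i, SubexponentialFamily P (Y i) (G i) v) :
    ∃ τ : ℝ, 0 < τ ∧ ∀ N : ℕ, 1 ≤ N → ∀ (Ω : Type*) [MeasurableSpace Ω] (μ : Measure Ω)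
      [IsProbabilityMeasure μ] (X : Fin N → Ω → α), iIndepFun X μ → (∀ i, HasLaw (X i) P μ) →
      ∀ lam : ℝ, 0 < lam → lam ≤ τ * Real.sqrt N → ∀ y ε : ℝ,
      Fintype.card ι * Real.exp (-(lam / 2 * y - (Real.log 2 +
        2 * Module.finrank ℝ E * Real.log 2 + 5 / 2 * (v * lam ^ 2)))) ≤ ε →
      ∃ A : Set Ω, MeasurableSet A ∧ 1 - ε ≤ μ.real A ∧
        ∀ o ∈ A, ∀ i, ∀ u ∈ Metric.closedBall (0 : E) 1,
          |(Real.sqrt N)⁻¹ * ∑ j, (Y i (X j o) u - ∫ z, Y i z u ∂P)| ≤ y := by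
  have hloc : ∀ i, ∃ τ : ℝ, 0 < τ ∧
      (∀ t : ℝ, |t| ≤ τ → ∫⁻ x, ENNReal.ofReal (Real.exp (t * (Y i x 0 - ∫ z, Y i z 0 ∂P))) ∂P ≤
        ENNReal.ofReal (Real.exp (v * t ^ 2))) ∧
      ∀ u w : E, ‖u‖ < 1 → ‖w‖ < 1 → ∀ t : ℝ, |t| * ‖u - w‖ ≤ 2 * τ →
        ∫⁻ x, ENNReal.ofReal (Real.exp
          (t * ((Y i x u - ∫ z, Y i z u ∂P) - (Y i x w - ∫ z, Y i z w ∂P)))) ∂P ≤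
          ENNReal.ofReal (Real.exp (v * (t * ‖u - w‖) ^ 2)) := by
    intro i
    obtain ⟨a, ha, K, hK⟩ := (h i).expMoment
    obtain ⟨τ₁, hτ₁, H₁⟩ := exists_forall_lintegral_exp_centered_le (P := P) ha K v
    obtain ⟨τ₂, hτ₂, C, H₂⟩ := (h i).exists_forall_increment
    -- The half is there because chaining uses increments at parameters up to `2 τ`.
    refine ⟨min τ₁ (τ₂ / 2), by positivity, fun t ht => ?_, fun u w hu hw t ht => ?_⟩
    · exact H₁ _ ((h i).measurable 0 (by simp)).aemeasurable (hK 0 (by simp)) (h i).variance_le t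
        (ht.trans (min_le_left _ _))
    · refine (H₂ u w hu hw).2 t (ht.trans ?_)
      linarith [min_le_right τ₁ (τ₂ / 2)]
  choose τ hτ hz hi using hloc
  obtain ⟨τ₀, hτ₀, hle⟩ : ∃ τ₀ : ℝ, 0 < τ₀ ∧ ∀ i, τ₀ ≤ τ i := by
    rcases isEmpty_or_nonempty ι with hι | hι
    · exact ⟨1, one_pos, fun i => hι.elim i⟩
    · obtain ⟨i, hmin⟩ := Finite.exists_min τ
      exact ⟨τ i, hτ i, hmin⟩
  refine ⟨τ₀, hτ₀, fun N hN Ω _ μ _ X hX hlaw lam hlam hlamle y ε hε => ?_⟩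
  have hN0 : (0 : ℝ) < N := by exact_mod_cast hN
  have hsN : 0 < Real.sqrt N := Real.sqrt_pos.2 hN0
  rcases isEmpty_or_nonempty ι with hι | ⟨⟨i₀⟩⟩
  · exact ⟨Set.univ, MeasurableSet.univ, by
      have : 0 ≤ ε := le_trans (by positivity) hε
      simpa using this, fun o _ i => hι.elim i⟩
  have hv := (h i₀).nonneg
  -- Normalising by `√N` cancels the factor `N` from independence, so the sub-Gaussian parameter
  -- stays `v`.
  have hr : ∀ b : ℝ, (N : ℝ) * (v * ((b / Real.sqrt N)) ^ 2) = v * b ^ 2 := fun b => by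
    rw [div_pow, Real.sq_sqrt hN0.le]
    field_simp
  have hscale : ∀ i, lam / Real.sqrt N ≤ τ i := fun i =>
    ((div_le_iff₀ hsN).2 hlamle).trans (hle i)
  have hYm : ∀ i, ∀ u : E, ‖u‖ ≤ 1 → Measurable fun x => Y i x u - ∫ z, Y i z u ∂P :=
    fun i u hu => ((h i).measurable u hu).sub_const _
  refine exists_measurableSet_forall_abs_le
    (ζ := fun i u o => (Real.sqrt N)⁻¹ * ∑ j, (Y i (X j o) u - ∫ z, Y i z u ∂P))
    hv hlam ?_ ?_ ?_ ?_ hε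
  · intro i u hu
    refine AEMeasurable.const_mul (Finset.aemeasurable_fun_sum _ fun j _ => ?_) _
    exact (hYm i u hu.le).comp_aemeasurable (hlaw j).aemeasurable
  · intro i o
    refine continuousOn_const.mul (continuousOn_finsetSum _ fun j _ => ?_)
    exact ((h i).continuousOn _).sub (h i).continuousOn_integral
  · intro i t ht
    have h1 := lintegral_exp_sum_le hX hlaw (hYm i 0 (by simp)) (hz i (t / Real.sqrt N) (by
      rw [abs_div, abs_of_pos hsN]
      exact (div_le_div_of_nonneg_right ht hsN.le).trans (hscale i)))
    rw [hr] at h1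
    simpa only [div_eq_mul_inv, mul_assoc] using h1
  · intro i u w hu hw t ht
    have h1 := lintegral_exp_sum_le hX hlaw ((hYm i u hu.le).sub (hYm i w hw.le))
      (hi i u w hu hw (t / Real.sqrt N) (by
        rw [abs_div, abs_of_pos hsN, div_mul_eq_mul_div]
        refine (div_le_div_of_nonneg_right ht hsN.le).trans ?_
        rw [mul_div_assoc]
        linarith [hscale i]))
    rw [div_mul_eq_mul_div, hr] at h1
    simpa only [div_eq_mul_inv, mul_assoc, Finset.sum_sub_distrib, ← mul_sub, Pi.sub_apply]
      using h1

end Increments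

/-! ### From the smoothness and covariance hypotheses to the abstract families. -/

section Families

variable {d : ℕ} {P : Measure (Euc d)} {f : Euc d → Euc d → ℝ}

lemma mem_unitBall {w : Euc d} : w ∈ unitBall d ↔ ‖w‖ ≤ 1 := by simp [unitBall]

lemma unitBall_mem_nhds {w : Euc d} (hw : ‖w‖ < 1) : unitBall d ∈ nhds w :=
  Filter.mem_of_superset (Metric.isOpen_ball.mem_nhds (by simpa using hw))
    Metric.ball_subset_closedBall

lemma uniqueDiffOn_unitBall (d : ℕ) : UniqueDiffOn ℝ (unitBall d) := by
  refine uniqueDiffOn_convex (convex_closedBall 0 1) ?_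
  rw [unitBall, interior_closedBall _ one_ne_zero]
  exact ⟨0, by simp⟩

lemma hasGradientAt_gradW {g : Euc d → Euc d → ℝ} {x : Euc d}
    (h : ContDiffOn ℝ 1 (g x) (unitBall d)) {w : Euc d} (hw : ‖w‖ < 1) :
    HasGradientAt (g x) (gradW g x w) w :=
  (hasGradientWithinAt_iff_hasFDerivWithinAt.1
    (h.differentiableOn one_ne_zero w (mem_unitBall.2 hw.le)).hasGradientWithinAt).hasFDerivAt
    (unitBall_mem_nhds hw)

lemma continuousOn_gradW {g : Euc d → Euc d → ℝ} {x : Euc d}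
    (h : ContDiffOn ℝ 1 (g x) (unitBall d)) : ContinuousOn (gradW g x) (Metric.ball 0 1) :=
  ((InnerProductSpace.toDual ℝ (Euc d)).symm.continuous.comp_continuousOn
    (h.continuousOn_fderivWithin (uniqueDiffOn_unitBall d) le_rfl)).mono
    Metric.ball_subset_closedBall

/-- The Loewner bound on a covariance matrix bounds the variances of all linear functionals. -/
lemma variance_inner_le_of_covMat [IsFiniteMeasure P] {Z : Euc d → Euc d} {v : ℝ}
    (hZ : ∀ k, MemLp (fun x => Z x k) 2 P)
    (h : (v • (1 : Matrix (Fin d) (Fin d) ℝ) - covMat P Z).PosSemidef) (hv : 0 ≤ v) {e : Euc d}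
    (he : ‖e‖ ≤ 1) : variance (fun x => inner ℝ (Z x) e) P ≤ v := by
  have h1 : (fun x => inner ℝ (Z x) e) = fun x => ∑ k, e k * Z x k := by
    funext x
    simp [PiLp.inner_apply]
  rw [h1, variance_fun_sum fun k => (hZ k).const_mul (e k)]
  simp_rw [covariance_const_mul_left, covariance_const_mul_right]
  have h2 := h.dotProduct_mulVec_nonneg e.ofLp
  rw [Matrix.sub_mulVec, dotProduct_sub, Matrix.smul_mulVec, Matrix.one_mulVec] at h2
  have h3 : star e.ofLp ⬝ᵥ (covMat P Z).mulVec e.ofLp =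
      ∑ k, ∑ l, e k * (e l * covariance (fun x => Z x k) (fun x => Z x l) P) := by
    simp only [dotProduct, Matrix.mulVec, covMat, Matrix.of_apply, Finset.mul_sum, star_trivial]
    refine Finset.sum_congr rfl fun k _ => Finset.sum_congr rfl fun l _ => ?_
    ring
  have h4 : star e.ofLp ⬝ᵥ v • e.ofLp = v * ‖e‖ ^ 2 := by
    rw [EuclideanSpace.real_norm_sq_eq, dotProduct_smul, smul_eq_mul]
    simp [dotProduct, sq]
  rw [h3, h4] at h2
  have h5 : ‖e‖ ^ 2 ≤ 1 := pow_le_one₀ (norm_nonneg _) he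
  nlinarith

/-- The Loewner bound controls the variance of every directional derivative once the gradient
coordinates are square integrable, which the exponential moment supplies. -/
lemma subexponentialFamily_of_covMat [IsProbabilityMeasure P] {Y : Euc d → Euc d → ℝ}
    {G : Euc d → Euc d → Euc d} {v : ℝ} (hm : ∀ w ∈ unitBall d, Measurable fun x => Y x w)
    (hc : ∀ x, ContinuousOn (Y x) (unitBall d))
    (hG : ∀ x w, ‖w‖ < 1 → HasGradientAt (Y x) (G x w) w)
    (hGc : ∀ x, ContinuousOn (G x) (Metric.ball 0 1))
    (hY : UniformExpMoment P Y) (hGexp : UniformExpMoment P G)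
    (hvar : ∀ w ∈ unitBall d, variance (fun x => Y x w) P ≤ v)
    (hcov : ∀ w ∈ unitBall d,
      (v • (1 : Matrix (Fin d) (Fin d) ℝ) - covMat P (fun x => G x w)).PosSemidef) :
    SubexponentialFamily P Y G v where
  measurable w hw := hm w (mem_unitBall.2 hw)
  continuousOn := hc
  hasGradientAt := hG
  continuousOn_gradient := hGc
  expMoment := by
    obtain ⟨a, ha, K, hK⟩ := hY
    exact ⟨a, ha, K, fun w hw => hK w (mem_unitBall.2 hw)⟩
  expMoment_gradient := by
    obtain ⟨a, ha, K, hK⟩ := hGexp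
    exact ⟨a, ha, K, fun w hw => hK w (mem_unitBall.2 hw.le)⟩
  variance_le := hvar 0 (mem_unitBall.2 (by simp))
  variance_gradient_le w hw e he := by
    obtain ⟨a, ha, K, hK⟩ := hGexp
    have hv : 0 ≤ v := (variance_nonneg _ _).trans (hvar 0 (mem_unitBall.2 (by simp)))
    refine variance_inner_le_of_covMat (fun k => ?_) (hcov w (mem_unitBall.2 hw.le)) hv he
    have hk : Measurable fun x => G x w k := by
      have := measurable_inner_gradient (fun w hw => hm w (mem_unitBall.2 hw.le)) hG hw
        (EuclideanSpace.single k (1 : ℝ))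
      simpa [EuclideanSpace.inner_single_right] using this
    refine memLp_two_of_lintegral_exp_le hk.aemeasurable ha (K := K)
      (le_trans (lintegral_mono fun x => ?_) (hK w (mem_unitBall.2 hw.le)))
    apply ENNReal.ofReal_le_ofReal
    have : |G x w k| ≤ ‖G x w‖ := PiLp.norm_apply_le (G x w) k
    gcongr

namespace SmoothFamily

lemma contDiff_left (hf : SmoothFamily f) {w : Euc d} (hw : w ∈ unitBall d) : ContDiff ℝ 1 fun x => f x w := by
  rw [← contDiffOn_univ]
  exact hf.contDiffOn.comp (f := fun x : Euc d => (x, w)) (by fun_prop) fun x _ => ⟨trivial, hw⟩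

lemma contDiffOn_right (hf : SmoothFamily f) (x : Euc d) : ContDiffOn ℝ 1 (f x) (unitBall d) :=
  hf.contDiffOn.comp (f := fun w : Euc d => (x, w)) (by fun_prop) fun _ hw => ⟨trivial, hw⟩

lemma continuous_gradient (hf : SmoothFamily f) {w : Euc d} (hw : w ∈ unitBall d) :
    Continuous fun x => gradient (fun y => f y w) x :=
  (InnerProductSpace.toDual ℝ (Euc d)).symm.continuous.comp
    ((hf.contDiff_left hw).continuous_fderiv one_ne_zero)

lemma continuous_partialX (hf : SmoothFamily f) (j : Fin d) {w : Euc d} (hw : w ∈ unitBall d) :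
    Continuous fun x => partialX f j x w := by
  have := hf.continuous_gradient hw
  unfold partialX
  fun_prop

lemma subexponentialFamily_coord_mul [IsProbabilityMeasure P] (hf : SmoothFamily f)
    (hexp : ExpMoments P f) {v : ℝ}
    (hvar : VarianceBounds P f v) (j : Fin d) :
    SubexponentialFamily P (fun x w => x j * f x w) (fun x w => x j • gradW f x w) v := by
  refine subexponentialFamily_of_covMat (fun w hw => ?_) (fun x => ?_) (fun x w hw => ?_)
    (fun x => ?_) (hexp.val j) (hexp.grad_val j) (hvar.val j) (hvar.grad_val j)
  · have := (hf.contDiff_left hw).continuous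
    exact Continuous.measurable (by fun_prop)
  · exact continuousOn_const.mul (hf.contDiffOn_right x).continuousOn
  · have := (hasGradientAt_gradW (hf.contDiffOn_right x) hw).hasFDerivAt.const_mul (x j)
    rw [hasGradientAt_iff_hasFDerivAt]
    simpa using this
  · exact (continuousOn_gradW (hf.contDiffOn_right x)).const_smul (x j)

lemma subexponentialFamily_partialX [IsProbabilityMeasure P] (hf : SmoothFamily f)
    (hexp : ExpMoments P f) {v : ℝ}
    (hvar : VarianceBounds P f v) (j : Fin d) :
    SubexponentialFamily P (partialX f j) (gradW (partialX f j)) v :=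
  subexponentialFamily_of_covMat (fun _ hw => (hf.continuous_partialX j hw).measurable)
    (fun x => (hf.contDiffOn_partialX j x).continuousOn)
    (fun x _ hw => hasGradientAt_gradW (hf.contDiffOn_partialX j x) hw)
    (fun x => continuousOn_gradW (hf.contDiffOn_partialX j x))
    (hexp.deriv j) (hexp.grad_deriv j) (hvar.deriv j) (hvar.grad_deriv j)

end SmoothFamily

end Families

/-! ### Stein's identity and the target space. -/

section IntegrationByParts

variable {d m : ℕ} {P : Measure (Euc d)} {S : Matrix (Fin d) (Fin d) ℝ}
  {T : Matrix (Fin m) (Fin d) ℝ} {q : Euc m → ℝ}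

lemma norm_le_sum_abs (x : Euc d) : ‖x‖ ≤ ∑ j, |x j| := by
  conv_lhs => rw [← (EuclideanSpace.basisFun (Fin d) ℝ).sum_repr x]
  refine (norm_sum_le _ _).trans (Finset.sum_le_sum fun j _ => ?_)
  simp [norm_smul]

/-- The Gaussian density is differentiable along lines, with logarithmic derivative `-S⁻¹ x`. -/
lemma hasDerivAt_gaussianDensity_line (hS : S.PosDef) (x v : Euc d) :
    HasDerivAt (fun t : ℝ => gaussianDensity S (x + t • v))
      (-(inner ℝ (Matrix.toEuclideanCLM (𝕜 := ℝ) S⁻¹ x) v) * gaussianDensity S x) 0 := by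
  set A := Matrix.toEuclideanCLM (𝕜 := ℝ) S⁻¹ with hA
  have hsymm : inner ℝ x (A v) = inner ℝ (A x) v := by
    have hT : (S⁻¹).transpose = S⁻¹ := by
      simpa [Matrix.IsHermitian, Matrix.conjTranspose_eq_transpose_of_trivial] using
        hS.inv.isHermitian
    rw [EuclideanSpace.inner_eq_star_dotProduct, EuclideanSpace.inner_eq_star_dotProduct, hA,
      Matrix.ofLp_toEuclideanCLM, Matrix.ofLp_toEuclideanCLM, star_trivial, star_trivial,
      dotProduct_comm, Matrix.dotProduct_mulVec, ← Matrix.mulVec_transpose, hT, dotProduct_comm]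
  have hline : HasDerivAt (fun t : ℝ => x + t • v) v 0 := by
    simpa using ((hasDerivAt_id (0 : ℝ)).smul_const v).const_add x
  have hAline : HasDerivAt (fun t : ℝ => A (x + t • v)) (A v) 0 :=
    A.hasFDerivAt.comp_hasDerivAt 0 hline
  have h1 := (((hline.inner ℝ hAline).const_mul (-(1 / 2) : ℝ)).exp).const_mul
    (Real.sqrt ((2 * Real.pi) ^ d * S.det))⁻¹
  refine h1.congr_deriv ?_
  simp only [zero_smul, add_zero]
  rw [hsymm, real_inner_comm (A x) v, gaussianDensity]
  ring

lemma continuous_gaussianDensity (S : Matrix (Fin d) (Fin d) ℝ) :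
    Continuous (gaussianDensity S : Euc d → ℝ) := by
  unfold gaussianDensity
  fun_prop

namespace NGModel

lemma continuous_density (hP : NGModel P S T q) :
    Continuous fun x : Euc d => gaussianDensity S x * q (Matrix.toEuclideanLin T x) := by
  have h1 := continuous_gaussianDensity S
  have h2 := hP.contDiff.continuous
  have h3 : Continuous (Matrix.toEuclideanLin T) := LinearMap.continuous_of_finiteDimensional _
  fun_prop

lemma density_nonneg (hP : NGModel P S T q) (x : Euc d) :
    0 ≤ gaussianDensity S x * q (Matrix.toEuclideanLin T x) :=
  mul_nonneg (mul_nonneg (by positivity) (Real.exp_pos _).le) (hP.nonneg _)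

lemma integrable_iff (hP : NGModel P S T q) {g : Euc d → ℝ} : Integrable g P ↔
    Integrable (fun x => g x * (gaussianDensity S x * q (Matrix.toEuclideanLin T x))) := by
  have h := integrable_withDensity_iff_integrable_smul (μ := (volume : Measure (Euc d)))
    (f := fun x => Real.toNNReal (gaussianDensity S x * q (Matrix.toEuclideanLin T x)))
    hP.continuous_density.measurable.real_toNNReal (g := g)
  rw [hP.density]
  refine h.trans (iff_of_eq (congrArg (Integrable · volume) (funext fun x => ?_)))
  rw [NNReal.smul_def, Real.coe_toNNReal _ (hP.density_nonneg x), smul_eq_mul, mul_comm]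

lemma integral_eq (hP : NGModel P S T q) (g : Euc d → ℝ) : ∫ x, g x ∂P =
    ∫ x, g x * (gaussianDensity S x * q (Matrix.toEuclideanLin T x)) := by
  have h := integral_withDensity_eq_integral_smul (μ := (volume : Measure (Euc d)))
    (f := fun x => Real.toNNReal (gaussianDensity S x * q (Matrix.toEuclideanLin T x)))
    hP.continuous_density.measurable.real_toNNReal g
  rw [hP.density]
  refine h.trans (integral_congr_ae (Filter.Eventually.of_forall fun x => ?_))
  simp only [NNReal.smul_def, Real.coe_toNNReal _ (hP.density_nonneg x), smul_eq_mul, mul_comm]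

/-- Stein's identity in directions along which the non-Gaussian factor is constant. -/
theorem integral_inner_gradient_eq (hP : NGModel P S T q) {h : Euc d → ℝ} (hh : ContDiff ℝ 1 h)
    (hmul : ∀ j, Integrable (fun x : Euc d => x j * h x) P)
    (hgrad : ∀ j, Integrable (fun x => gradient h x j) P) {v : Euc d}
    (hv : Matrix.toEuclideanLin T v = 0) :
    ∫ x, inner ℝ (gradient h x) v ∂P =
      ∫ x, h x * inner ℝ (Matrix.toEuclideanCLM (𝕜 := ℝ) S⁻¹ x) v ∂P := by
  have := hP.isProbabilityMeasure
  set A := Matrix.toEuclideanCLM (𝕜 := ℝ) S⁻¹ with hA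
  -- On the unit ball `h` is bounded; outside it `|h| ≤ ∑ j, |x j * h x|`.
  have hhint : Integrable h P := by
    obtain ⟨C, hC⟩ := (isCompact_closedBall (0 : Euc d) 1).exists_bound_of_continuousOn
      hh.continuous.continuousOn
    refine ((integrable_const |C|).add (integrable_finsetSum Finset.univ
      fun j _ => (hmul j).abs)).mono' hh.continuous.aestronglyMeasurable
      (Filter.Eventually.of_forall fun x => ?_)
    simp only [Pi.add_apply, abs_mul, ← Finset.sum_mul]
    have h0 : 0 ≤ ∑ j, |x j| := Finset.sum_nonneg fun _ _ => abs_nonneg _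
    rcases le_or_gt ‖x‖ 1 with hx | hx
    · have := (hC x (by simpa using hx)).trans (le_abs_self C)
      have := mul_nonneg h0 (abs_nonneg (h x))
      linarith
    · have h1 := hx.le.trans (norm_le_sum_abs x)
      have := mul_le_mul_of_nonneg_right h1 (abs_nonneg (h x))
      rw [Real.norm_eq_abs]
      linarith [abs_nonneg C]
  have hg1 : Integrable (fun x => inner ℝ (gradient h x) v) P := by
    simp only [PiLp.inner_apply]
    exact integrable_finsetSum _ fun j _ => by simpa using (hgrad j).const_mul (v j)
  have hg2 : Integrable (fun x => h x * inner ℝ (A x) v) P := by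
    have h1 : ∀ x : Euc d, h x * inner ℝ (A x) v =
        ∑ j, inner ℝ (A (EuclideanSpace.single j 1)) v * (x j * h x) := by
      intro x
      have hx : A x = ∑ j, x j • A (EuclideanSpace.single j 1) := by
        conv_lhs => rw [← (EuclideanSpace.basisFun (Fin d) ℝ).sum_repr x]
        simp [map_sum]
      rw [hx, sum_inner, Finset.mul_sum]
      refine Finset.sum_congr rfl fun j _ => ?_
      rw [real_inner_smul_left]
      ring
    simp_rw [h1]
    exact integrable_finsetSum _ fun j _ => (hmul j).const_mul _
  set ρ : Euc d → ℝ := fun x => gaussianDensity S x * q (Matrix.toEuclideanLin T x) with hρ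
  -- Since `T v = 0`, only `h` and the Gaussian factor vary along `v`; no derivative of `q` occurs.
  have hline : ∀ x, HasLineDerivAt ℝ (fun x => h x * ρ x)
      ((inner ℝ (gradient h x) v - h x * inner ℝ (A x) v) * ρ x) x v := by
    intro x
    have h1 : HasDerivAt (fun t : ℝ => h (x + t • v)) (inner ℝ (gradient h x) v) 0 :=
      HasGradientAt.hasDerivAt_comp_line
        (by simpa using (hh.differentiable one_ne_zero x).hasGradientAt)
    have h2 := h1.mul ((hasDerivAt_gaussianDensity_line hP.posDef x v).mul_const
      (q (Matrix.toEuclideanLin T x)))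
    have hfun : (fun t : ℝ => h (x + t • v) * ρ (x + t • v)) = (fun t : ℝ => h (x + t • v)) *
        fun t : ℝ => gaussianDensity S (x + t • v) * q (Matrix.toEuclideanLin T x) := by
      funext t
      simp only [hρ, Pi.mul_apply, map_add, map_smul, hv, smul_zero, add_zero]
    rw [HasLineDerivAt, hfun]
    refine h2.congr_deriv ?_
    simp only [hρ, zero_smul, add_zero, hA]
    ring
  have hd : Integrable (fun x => (inner ℝ (gradient h x) v - h x * inner ℝ (A x) v) * ρ x) :=
    hP.integrable_iff.1 (hg1.sub hg2)
  -- Integration by parts against the constant `1`: the line derivative of an integrable function,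
  -- itself integrable, has integral zero.
  have hibp := integral_bilinear_hasLineDerivAt_right_eq_neg_left_of_integrable
    (μ := (volume : Measure (Euc d))) (B := ContinuousLinearMap.mul ℝ ℝ) (v := v)
    (f := fun _ => (1 : ℝ)) (f' := fun _ => 0) (g := fun x => h x * ρ x)
    (g' := fun x => (inner ℝ (gradient h x) v - h x * inner ℝ (A x) v) * ρ x)
    (by simp) (by simpa using hd) (by simpa using hP.integrable_iff.1 hhint)
    (fun x _ => by simpa [HasLineDerivAt] using hasDerivAt_const (0 : ℝ) (1 : ℝ))
    (fun x _ => hline x)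
  simp only [ContinuousLinearMap.mul_apply', one_mul, zero_mul, integral_zero, neg_zero] at hibp
  rw [← hP.integral_eq (fun x => inner ℝ (gradient h x) v - h x * inner ℝ (A x) v),
    integral_sub hg1 hg2] at hibp
  linarith

end NGModel

/-- If `v` is orthogonal to the range of the transpose, then `‖T v‖² = ⟨Tᵀ T v, v⟩ = 0`, so the
orthogonal complement of the target space lies in `ker T`; take complements again. -/
lemma mem_targetSpace_of_forall_inner_eq_zero {u : Euc d}
    (h : ∀ v : Euc d, Matrix.toEuclideanLin T v = 0 → inner ℝ u v = 0) : u ∈ targetSpace T := by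
  rw [← (targetSpace T).orthogonal_orthogonal, Submodule.mem_orthogonal']
  intro v hv
  refine h v ?_
  rw [← inner_self_eq_zero (𝕜 := ℝ)]
  have h1 := (Submodule.mem_orthogonal _ _).1 hv
    (Matrix.toEuclideanLin T.transpose (Matrix.toEuclideanLin T v)) ⟨_, rfl⟩
  rw [← Matrix.conjTranspose_eq_transpose_of_trivial, Matrix.toEuclideanLin_conjTranspose_eq_adjoint,
    LinearMap.adjoint_inner_left] at h1
  exact h1

end IntegrationByParts

/-! ### Optimising the rate and assembling the bound. -/

/-- The function `t ↦ a t + b / t` attains its infimum on `(0, M]`. -/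
lemma exists_isLeast_linear_add_inv {a b M : ℝ} (ha : 0 ≤ a) (hb : 0 < b) (hM : 0 < M) :
    ∃ t ∈ Set.Ioc 0 M, IsLeast ((fun t : ℝ => a * t + b * t⁻¹) '' Set.Ioc 0 M)
      (a * t + b * t⁻¹) := by
  set F : ℝ → ℝ := fun t => a * t + b * t⁻¹ with hF
  have hFM : 0 < F M := by positivity
  -- For `s < r` the term `b / s` alone is at least `F M`, so the minimum may be sought on the
  -- compact interval `[r, M]`.
  set r := min M (b / F M) with hr
  have hr0 : 0 < r := by positivity
  have hcont : ContinuousOn F (Set.Icc r M) := by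
    refine (continuousOn_const.mul continuousOn_id).add (continuousOn_const.mul
      (continuousOn_id.inv₀ fun t ht => ?_))
    exact (hr0.trans_le ht.1).ne'
  obtain ⟨t, ht, hmin⟩ := isCompact_Icc.exists_isMinOn ⟨M, min_le_left _ _, le_rfl⟩ hcont
  refine ⟨t, ⟨hr0.trans_le ht.1, ht.2⟩, ⟨t, ⟨hr0.trans_le ht.1, ht.2⟩, rfl⟩, ?_⟩
  rintro _ ⟨s, ⟨hs0, hsM⟩, rfl⟩
  rcases le_or_gt r s with h | h
  · exact hmin ⟨h, hsM⟩
  · have h1 : F t ≤ F M := hmin ⟨min_le_left _ _, le_rfl⟩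
    have h2 : F M ≤ b * s⁻¹ := by
      have h3 : s ≤ b / F M := h.le.trans (min_le_right _ _)
      rw [le_div_iff₀ hFM] at h3
      rw [← div_eq_mul_inv, le_div_iff₀ hs0]
      linarith
    have h4 : 0 ≤ a * s := by positivity
    exact h1.trans (h2.trans (by simp only [hF]; linarith))

lemma norm_le_sqrt_mul_of_forall_abs_le {d : ℕ} {z : Euc d} {r : ℝ} (hr : 0 ≤ r)
    (h : ∀ j, |z j| ≤ r) : ‖z‖ ≤ Real.sqrt d * r := by
  rw [EuclideanSpace.norm_eq]
  refine Real.sqrt_le_iff.2 ⟨by positivity, ?_⟩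
  rw [mul_pow, Real.sq_sqrt (Nat.cast_nonneg d)]
  calc ∑ j, ‖z j‖ ^ 2 ≤ ∑ _j : Fin d, r ^ 2 :=
        Finset.sum_le_sum fun j _ => pow_le_pow_left₀ (norm_nonneg _) (h j) 2
    _ = d * r ^ 2 := by simp

lemma abs_sum_mul_le {ι : Type*} [Fintype ι] {c b : ι → ℝ} {r : ℝ} (hr : 0 ≤ r)
    (hc : ∑ l, |c l| ≤ 1) (hb : ∀ l, |b l| ≤ r) : |∑ l, c l * b l| ≤ r :=
  calc |∑ l, c l * b l| ≤ ∑ l, |c l| * r :=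
        (Finset.abs_sum_le_sum_abs _ _).trans (Finset.sum_le_sum fun l _ => by
          rw [abs_mul]; exact mul_le_mul_of_nonneg_left (hb l) (abs_nonneg _))
    _ = (∑ l, |c l|) * r := by rw [Finset.sum_mul]
    _ ≤ r := mul_le_of_le_one_left hr hc

/-- Distance from a perturbed point to a subspace, when the unperturbed point lies in it up to the
image of a small vector. -/
lemma norm_sub_starProjection_le {E : Type*} [NormedAddCommGroup E] [InnerProductSpace ℝ E]
    (K : Submodule ℝ E) [K.HasOrthogonalProjection] (A : E →L[ℝ] E) {z b g : E} {r : ℝ}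
    (hmem : b - A g ∈ K) (hz : ‖z - b‖ ≤ r) (hg : ‖g‖ ≤ r) :
    ‖z - K.starProjection z‖ ≤ r * (1 + ‖A‖) := by
  -- The projection onto the complement annihilates `b - A g` and has norm at most one.
  have h1 : z - K.starProjection z = Kᗮ.starProjection ((z - b) + A g) := by
    have h2 : Kᗮ.starProjection (b - A g) = 0 := by
      rw [Submodule.starProjection_orthogonal_val,
        Submodule.starProjection_eq_self_iff.2 hmem, sub_self]
    rw [← Submodule.starProjection_orthogonal_val]
    calc Kᗮ.starProjection z = Kᗮ.starProjection (((z - b) + A g) + (b - A g)) := by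
          congr 1; abel
      _ = _ := by rw [map_add, h2, add_zero]
  rw [h1]
  refine (Submodule.norm_starProjection_apply_le _ _).trans ((norm_add_le _ _).trans ?_)
  have := (A.le_opNorm g).trans (mul_le_mul_of_nonneg_left hg (norm_nonneg A))
  linarith

/-- The vector `E ∇h - S⁻¹ E[X h]`, with `h = f (·, w)`, lies in the target space. -/
lemma sub_toEuclideanCLM_mem_targetSpace {d m : ℕ} {P : Measure (Euc d)}
    {S : Matrix (Fin d) (Fin d) ℝ} {T : Matrix (Fin m) (Fin d) ℝ} {q : Euc m → ℝ}
    (hP : NGModel P S T q) {f : Euc d → Euc d → ℝ} (hf : SmoothFamily f) {w : Euc d}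
    (hw : w ∈ unitBall d) (hmul : ∀ j, Integrable (fun x : Euc d => x j * f x w) P)
    (hpart : ∀ j, Integrable (fun x => partialX f j x w) P) :
    WithLp.toLp 2 (fun j => ∫ x, partialX f j x w ∂P) - Matrix.toEuclideanCLM (𝕜 := ℝ) S⁻¹
      (WithLp.toLp 2 fun j => ∫ x, x j * f x w ∂P) ∈ targetSpace T := by
  refine mem_targetSpace_of_forall_inner_eq_zero fun v hv => ?_
  have h := hP.integral_inner_gradient_eq (hf.contDiff_left hw) hmul hpart hv
  have h1 : ∫ x, inner ℝ (gradient (fun y => f y w) x) v ∂P =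
      inner ℝ (WithLp.toLp 2 (fun j => ∫ x, partialX f j x w ∂P)) v := by
    simp only [PiLp.inner_apply, RCLike.inner_apply, conj_trivial]
    refine (integral_finsetSum _ fun j _ => (hpart j).const_mul (v j)).trans ?_
    exact Finset.sum_congr rfl fun j _ => integral_const_mul _ _
  have h2 : ∫ x, f x w * inner ℝ (Matrix.toEuclideanCLM (𝕜 := ℝ) S⁻¹ x) v ∂P =
      inner ℝ (Matrix.toEuclideanCLM (𝕜 := ℝ) S⁻¹
        (WithLp.toLp 2 fun j => ∫ x, x j * f x w ∂P)) v := by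
    obtain ⟨a, ha⟩ : ∃ a : Fin d → ℝ, ∀ x : Euc d,
        inner ℝ (Matrix.toEuclideanCLM (𝕜 := ℝ) S⁻¹ x) v = ∑ j, x j * a j := by
      refine ⟨fun j => inner ℝ (Matrix.toEuclideanCLM (𝕜 := ℝ) S⁻¹ (EuclideanSpace.single j 1)) v,
        fun x => ?_⟩
      conv_lhs => rw [← (EuclideanSpace.basisFun (Fin d) ℝ).sum_repr x]
      simp [map_sum, sum_inner, real_inner_smul_left]
    have hmul' : ∀ x j, f x w * (x j * a j) = x j * f x w * a j := fun x j => by ring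
    simp only [ha, Finset.mul_sum, hmul']
    rw [integral_finsetSum _ fun j _ => (hmul j).mul_const (a j)]
    exact Finset.sum_congr rfl fun j _ => integral_mul_const _ _
  rw [inner_sub_left, ← h1, ← h2, h, sub_self]

theorem theorem2 {d m : ℕ} (P : Measure (Euc d)) (S : Matrix (Fin d) (Fin d) ℝ)
    (T : Matrix (Fin m) (Fin d) ℝ) (q : Euc m → ℝ) (hP : NGModel P S T q)
    (f : Euc d → Euc d → ℝ) (hf : SmoothFamily f) (hexp : ExpMoments P f)
    (f1 : ℝ) (hvar : VarianceBounds P f f1) (n0 : ℝ) (hn0 : 1 < n0) :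
    ∃ lam : ℝ, 0 < lam ∧
      ∀ (N : ℕ), 1 ≤ N →
      ∀ (Ω : Type*) [MeasurableSpace Ω] (μ : Measure Ω) [IsProbabilityMeasure μ]
        (X : Fin N → Ω → Euc d), iIndepFun X μ → (∀ i, HasLaw (X i) P μ) →
      ∀ (L : ℕ) (w : Fin L → Euc d), (∀ l, w l ∈ unitBall d) →
      ∀ ε : ℝ, 0 < ε →
      ∃ A : Set Ω, MeasurableSet A ∧ 1 - ε ≤ μ.real A ∧
        ∀ o ∈ A, ∀ c ∈ feasibleSet f w (fun i => X i o),
          ‖betaHat f w (fun i => X i o) c -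
              (targetSpace T).starProjection (betaHat f w (fun i => X i o) c)‖ ≤
            Real.sqrt d * deltaN d N n0 f1 lam ε *
              (1 + ‖Matrix.toEuclideanCLM (𝕜 := ℝ) S⁻¹‖) := by
  have := hP.isProbabilityMeasure
  let Y : Fin d ⊕ Fin d → Euc d → Euc d → ℝ :=
    Sum.elim (fun j x w => x j * f x w) (fun j => partialX f j)
  let G : Fin d ⊕ Fin d → Euc d → Euc d → Euc d :=
    Sum.elim (fun j x w => x j • gradW f x w) (fun j => gradW (partialX f j))
  have hYG : ∀ i, SubexponentialFamily P (Y i) (G i) f1 := by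
    rintro (j | j)
    exacts [hf.subexponentialFamily_coord_mul hexp hvar j,
      hf.subexponentialFamily_partialX hexp hvar j]
  obtain ⟨τ, hτ, H⟩ := exists_forall_empirical_deviation_le hYG
  refine ⟨τ, hτ, fun N hN Ω _ μ _ X hX hlaw L w hw ε hε => ?_⟩
  -- The case `d = 0` takes place in a one-point space; for `ε ≥ 1` the empty event suffices.
  -- Otherwise `2 d / ε > 1`, so the logarithm in the rate is positive.
  rcases Nat.eq_zero_or_pos d with rfl | hd
  · refine ⟨Set.univ, MeasurableSet.univ, by simpa using hε.le, fun o _ c _ => ?_⟩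
    rw [Subsingleton.elim (betaHat f w (fun i => X i o) c - _) 0]
    simp
  rcases le_or_gt 1 ε with hε1 | hε1
  · exact ⟨∅, MeasurableSet.empty, by simpa using hε1, fun o ho => ho.elim⟩
  have hd1 : (1 : ℝ) ≤ d := by exact_mod_cast hd
  have hN0 : (0 : ℝ) < N := by exact_mod_cast hN
  have hsN : 0 < Real.sqrt N := Real.sqrt_pos.2 hN0
  have hf1 : 0 ≤ f1 := (hYG (Sum.inl ⟨0, hd⟩)).nonneg
  have hlog2 : 0 < Real.log 2 := Real.log_pos one_lt_two
  have hlogε : 0 < Real.log (2 * d / ε) := by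
    refine Real.log_pos ?_
    rw [lt_div_iff₀ hε]
    linarith
  -- The infimum in the rate is attained, so a single `t`, and thus a single event, realises it
  -- exactly.
  obtain ⟨t, ⟨ht0, htM⟩, htmin⟩ := exists_isLeast_linear_add_inv (a := 5 * n0 * f1)
    (b := 2 * (4 * d * Real.log 2 + Real.log (2 * d / ε))) (M := τ * Real.sqrt N)
    (by positivity) (by positivity) (by positivity)
  set y : ℝ := 5 * n0 * f1 * t + 2 * (4 * d * Real.log 2 + Real.log (2 * d / ε)) * t⁻¹ with hy
  have hy0 : 0 ≤ y := by positivity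
  have hδ : deltaN d N n0 f1 τ ε = (Real.sqrt N)⁻¹ * y := by
    rw [deltaN, ← htmin.csInf_eq]
    congr 3
    funext s
    ring
  obtain ⟨A, hA, hμA, hdev⟩ := H N hN Ω μ X hX hlaw t ht0 htM y ε (by
    -- After the chaining cost `log 2 + 2 d log 2 + (5 / 2) f1 t ^ 2` is paid, at least `log (2 d /
    -- ε)` remains in the exponent, matching the union over `2 d` processes. The cost is covered
    -- since `d ≥ 1` and `n0 ≥ 1`.
    have h1 : t / 2 * y = 5 / 2 * (n0 * f1 * t ^ 2) +
        (4 * d * Real.log 2 + Real.log (2 * d / ε)) := by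
      rw [hy]; field_simp
    have h2 : f1 * t ^ 2 ≤ n0 * f1 * t ^ 2 := by
      rw [mul_assoc]
      exact le_mul_of_one_le_left (by positivity) hn0.le
    have h3 : Real.log 2 ≤ d * Real.log 2 := le_mul_of_one_le_left hlog2.le hd1
    have hd0 : (0 : ℝ) < 2 * d / ε := by positivity
    calc (Fintype.card (Fin d ⊕ Fin d) : ℝ) * Real.exp _
        ≤ 2 * d * Real.exp (-Real.log (2 * d / ε)) := by
          refine mul_le_mul (le_of_eq ?_) (Real.exp_le_exp.2 ?_) (Real.exp_pos _).le (by positivity)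
          · simp; ring
          · rw [h1, finrank_euclideanSpace_fin]
            linarith
      _ = ε := by
          rw [Real.exp_neg, Real.exp_log hd0]
          field_simp)
  refine ⟨A, hA, hμA, fun o ho c hc => ?_⟩
  obtain ⟨hc1, hc0⟩ := hc
  set r : ℝ := (Real.sqrt N)⁻¹ * y with hr
  have hr0 : 0 ≤ r := by positivity
  have hdev' : ∀ i l, |(N : ℝ)⁻¹ * ∑ j, Y i (X j o) (w l) - ∫ z, Y i z (w l) ∂P| ≤ r := by
    intro i l
    have h1 := hdev o ho i (w l) (hw l)
    have h2 : (N : ℝ)⁻¹ * ∑ j, Y i (X j o) (w l) - ∫ z, Y i z (w l) ∂P =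
        (Real.sqrt N)⁻¹ * ((Real.sqrt N)⁻¹ * ∑ j, (Y i (X j o) (w l) - ∫ z, Y i z (w l) ∂P)) := by
      rw [← mul_assoc, ← mul_inv, Real.mul_self_sqrt hN0.le, Finset.sum_sub_distrib,
        Finset.sum_const, Finset.card_univ, Fintype.card_fin, nsmul_eq_mul]
      field_simp
    rw [h2, abs_mul, abs_of_pos (inv_pos.2 hsN)]
    exact mul_le_mul_of_nonneg_left h1 (inv_pos.2 hsN).le
  set b : Fin L → Euc d := fun l => WithLp.toLp 2 fun j => ∫ x, partialX f j x (w l) ∂P with hb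
  set g : Fin L → Euc d := fun l => WithLp.toLp 2 fun j => ∫ x, x j * f x (w l) ∂P with hg
  have hmem : (∑ l, c l • b l) - Matrix.toEuclideanCLM (𝕜 := ℝ) S⁻¹ (∑ l, c l • g l) ∈
      targetSpace T := by
    rw [map_sum, ← Finset.sum_sub_distrib]
    refine Submodule.sum_mem _ fun l _ => ?_
    rw [map_smul, ← smul_sub]
    exact Submodule.smul_mem _ _ (sub_toEuclideanCLM_mem_targetSpace hP hf (hw l)
      (fun j => (hYG (Sum.inl j)).integrable (mem_unitBall.1 (hw l)))
      (fun j => (hYG (Sum.inr j)).integrable (mem_unitBall.1 (hw l))))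
  have hbeta : ‖betaHat f w (fun i => X i o) c - ∑ l, c l • b l‖ ≤ Real.sqrt d * r := by
    refine norm_le_sqrt_mul_of_forall_abs_le hr0 fun j => ?_
    have h1 : (betaHat f w (fun i => X i o) c - ∑ l, c l • b l) j =
        ∑ l, c l * ((N : ℝ)⁻¹ * ∑ i, partialX f j (X i o) (w l) -
          ∫ z, partialX f j z (w l) ∂P) := by
      simp [betaHat, partialX, hb, mul_sub, Finset.sum_sub_distrib]
    rw [h1]
    exact abs_sum_mul_le hr0 hc1 fun l => hdev' (Sum.inr j) l
  have hgamma : ‖∑ l, c l • g l‖ ≤ Real.sqrt d * r := by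
    -- Feasibility enters here: replacing `0` by `gammaHat` turns the population vector into a
    -- sampling error.
    rw [← norm_neg, ← zero_sub, ← hc0]
    refine norm_le_sqrt_mul_of_forall_abs_le hr0 fun j => ?_
    have h1 : (gammaHat f w (fun i => X i o) c - ∑ l, c l • g l) j =
        ∑ l, c l * ((N : ℝ)⁻¹ * ∑ i, X i o j * f (X i o) (w l) -
          ∫ z, z j * f z (w l) ∂P) := by
      simp [gammaHat, hg, mul_sub, Finset.sum_sub_distrib, mul_comm]
    rw [h1]
    exact abs_sum_mul_le hr0 hc1 fun l => hdev' (Sum.inl j) l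
  rw [hδ]
  exact norm_sub_starProjection_le _ _ hmem hbeta hgamma
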